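/- Theorem. There are a fixed algorithm (a program of a unit-cost random access machine over the reals, independent of all instance data) and a constant $C$ with the following property. Let $N$ be a set of $n\ge 1$ agents and $M$ a set of $m\ge 0$ indivisible goods. Let $w_i>0$ $(i\in N)$ be arbitrary positive weights, and let the agents have additive utilities $v_i(S)=\sum_{e\in S}v_i(e)$ that are bivalued, i.e. there are reals $a>b>0$ with $v_i(e)\in\{a,b\}$ for all $i\in N$, $e\in M$; put $k=a/b$ (so that $v_i(e)\in\{1,k\}$ after rescaling). On input $n$, $m$, $(w_i)_{i\in N}$, $(v_i(e))_{i\in N,\,e\in M}$ the algorithm stops after at most $C\cdot(\min\{k,m\}\,n^2m^2+1)$ steps, hence in polynomial time $O(\min\{k,m\}\,n^2m^2)$, and outputs an allocation $X=(X_i)_{i\in N}$ (a partition of $M$ into $n$ possibly empty bundles) which is 1. weighted equitable up to any good (WEQX): $\dfrac{v_i(X_i)}{w_i}\ge\dfrac{v_j(X_j\setminus\{e\})}{w_j}$ for all $i,j\in N$ and every $e\in X_j$; and 2. fractionally Pareto optimal (fPO): there is no fractional allocation $y=(y_{i,e})$, with $y_{i,e}\ge 0$ and $\sum_{i\in N}y_{i,e}=1$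 for every $e\in M$, such that $\sum_{e\in M}y_{i,e}v_i(e)\ge v_i(X_i)$ for all $i\in N$, with strict inequality for at least one agent. In the machine model, each arithmetic operation on reals ($+,-,\times,\div$), each addition or truncated subtraction of natural numbers, each copy, constant assignment, indirect read or write of an array cell, and each comparison costs one step. -/

import Mathlib

/-! ### Allocations of indivisible goods

Agents are `Fin n`, goods are `Fin m`. The additive utilities are given by the values
`v i e` of single goods, the weights by `w i`. An (integral) allocation, i.e. a partition of the
goods into `n` bundles, is given by the map sending every good to the agent who receives it. -/

/-- The utility of agent `i` for a bundle `S` of goods: utilities are additive. -/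
noncomputable def bundleValue {n m : ℕ} (v : Fin n → Fin m → ℝ) (i : Fin n)
    (S : Finset (Fin m)) : ℝ :=
  ∑ e ∈ S, v i e

/-- The bundle of agent `i` in the allocation that gives every good `e` to agent `X e`. -/
def bundle {n m : ℕ} (X : Fin m → Fin n) (i : Fin n) : Finset (Fin m) :=
  Finset.univ.filter (fun e => X e = i)

/-- Weighted equitability up to any good. -/
def IsWEQX {n m : ℕ} (w : Fin n → ℝ) (v : Fin n → Fin m → ℝ) (X : Fin m → Fin n) : Prop :=
  ∀ i j : Fin n, ∀ e ∈ bundle X j,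
    bundleValue v j (bundle X j \ {e}) / w j ≤ bundleValue v i (bundle X i) / w i

/-- A fractional allocation: agent `i` receives the fraction `x i e` of good `e`, and every good
is completely distributed. -/
def IsFracAllocation {n m : ℕ} (x : Fin n → Fin m → ℝ) : Prop :=
  (∀ i e, 0 ≤ x i e) ∧ ∀ e, ∑ i, x i e = 1

/-- The utility of agent `i` in the fractional allocation `x`. -/
noncomputable def fracValue {n m : ℕ} (v : Fin n → Fin m → ℝ) (x : Fin n → Fin m → ℝ)
    (i : Fin n) : ℝ :=
  ∑ e, x i e * v i e

/-- Fractional Pareto optimality: no fractional allocation dominates `X`. -/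
def IsFPO {n m : ℕ} (v : Fin n → Fin m → ℝ) (X : Fin m → Fin n) : Prop :=
  ¬ ∃ y : Fin n → Fin m → ℝ, IsFracAllocation y ∧
    (∀ i, bundleValue v i (bundle X i) ≤ fracValue v y i) ∧
    ∃ j, bundleValue v j (bundle X j) < fracValue v y j

/-! ### A unit-cost random access machine over the real numbers

The machine has registers for natural numbers and registers for real numbers, and arrays of natural
numbers and of real numbers that are accessed by indirect addressing. A program is a finite text, so
it mentions only finitely many registers and arrays; the arrays are unbounded. Every
elementary instruction and every evaluation of a test costs one step. On natural numbers there are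
only addition and (truncated) subtraction, on real numbers the four arithmetic operations; real
numbers can be compared but never be converted into natural numbers. -/

/-- A memory state. -/
structure MemState where
  /-- registers for natural numbers -/
  reg : ℕ → ℕ
  /-- registers for real numbers -/
  rreg : ℕ → ℝ
  /-- `arr a j` is cell `j` of the natural number array `a` -/
  arr : ℕ → ℕ → ℕ
  /-- `rarr a j` is cell `j` of the real number array `a` -/
  rarr : ℕ → ℕ → ℝ

/-- The elementary instructions. The first argument `d` (if there is one) is the destination
register, `x` and `y` are source registers, `a` is an array, `c` is a constant. -/
inductive Instr : Type
  | const (d c : ℕ)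
  | copy (d x : ℕ)
  | add (d x y : ℕ)
  | sub (d x y : ℕ)
  | load (d a x : ℕ)
  | store (a x y : ℕ)
  | rconst (d c : ℕ)
  | rcopy (d x : ℕ)
  | radd (d x y : ℕ)
  | rsub (d x y : ℕ)
  | rmul (d x y : ℕ)
  | rdiv (d x y : ℕ)
  | rload (d a x : ℕ)
  | rstore (a x y : ℕ)

/-- Writing a natural number register. -/
def MemState.setReg (s : MemState) (d z : ℕ) : MemState :=
  { s with reg := Function.update s.reg d z }

/-- Writing a real number register. -/
noncomputable def MemState.setRReg (s : MemState) (d : ℕ) (z : ℝ) : MemState :=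
  { s with rreg := Function.update s.rreg d z }

/-- Writing cell `j` of the natural number array `a`. -/
def MemState.setArr (s : MemState) (a j z : ℕ) : MemState :=
  { s with arr := Function.update s.arr a (Function.update (s.arr a) j z) }

/-- Writing cell `j` of the real number array `a`. -/
noncomputable def MemState.setRArr (s : MemState) (a j : ℕ) (z : ℝ) : MemState :=
  { s with rarr := Function.update s.rarr a (Function.update (s.rarr a) j z) }

/-- The effect of an elementary instruction. (A division by zero yields zero; this gives no
additional power, because real numbers can be tested for being zero.) -/
noncomputable def Instr.run : Instr → MemState → MemState
  | .const d c, s => s.setReg d c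
  | .copy d x, s => s.setReg d (s.reg x)
  | .add d x y, s => s.setReg d (s.reg x + s.reg y)
  | .sub d x y, s => s.setReg d (s.reg x - s.reg y)
  | .load d a x, s => s.setReg d (s.arr a (s.reg x))
  | .store a x y, s => s.setArr a (s.reg x) (s.reg y)
  | .rconst d c, s => s.setRReg d (c : ℝ)
  | .rcopy d x, s => s.setRReg d (s.rreg x)
  | .radd d x y, s => s.setRReg d (s.rreg x + s.rreg y)
  | .rsub d x y, s => s.setRReg d (s.rreg x - s.rreg y)
  | .rmul d x y, s => s.setRReg d (s.rreg x * s.rreg y)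
  | .rdiv d x y, s => s.setRReg d (s.rreg x / s.rreg y)
  | .rload d a x, s => s.setRReg d (s.rarr a (s.reg x))
  | .rstore a x y, s => s.setRArr a (s.reg x) (s.rreg y)

/-- The tests: comparisons of two registers. -/
inductive Test : Type
  | lt (x y : ℕ)
  | eq (x y : ℕ)
  | rlt (x y : ℕ)

/-- The truth of a test in a memory state. -/
def Test.Holds : Test → MemState → Prop
  | .lt x y, s => s.reg x < s.reg y
  | .eq x y, s => s.reg x = s.reg y
  | .rlt x y, s => s.rreg x < s.rreg y

/-- Programs: elementary instructions, composition, case distinction, and while loops. -/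
inductive Prog : Type
  | skip
  | instr (c : Instr)
  | seq (p q : Prog)
  | cond (t : Test) (p q : Prog)
  | loop (t : Test) (p : Prog)

/-- `Exec p s t s'`: the program `p`, started in the memory state `s`, terminates after exactly
`t` steps in the memory state `s'`. -/
inductive Exec : Prog → MemState → ℕ → MemState → Prop
  | skip (s : MemState) : Exec .skip s 1 s
  | instr (c : Instr) (s : MemState) : Exec (.instr c) s 1 (c.run s)
  | seq {p q : Prog} {s s' s'' : MemState} {t t' : ℕ} :
      Exec p s t s' → Exec q s' t' s'' → Exec (.seq p q) s (t + t') s''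
  | condTrue {b : Test} {p q : Prog} {s s' : MemState} {t : ℕ} :
      b.Holds s → Exec p s t s' → Exec (.cond b p q) s (1 + t) s'
  | condFalse {b : Test} {p q : Prog} {s s' : MemState} {t : ℕ} :
      ¬ b.Holds s → Exec q s t s' → Exec (.cond b p q) s (1 + t) s'
  | loopFalse {b : Test} {p : Prog} {s : MemState} :
      ¬ b.Holds s → Exec (.loop b p) s 1 s
  | loopTrue {b : Test} {p : Prog} {s s' s'' : MemState} {t t' : ℕ} :
      b.Holds s → Exec p s t s' → Exec (.loop b p) s' t' s'' →
        Exec (.loop b p) s (1 + t + t') s''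

/-- The input: the numbers `n` and `m` stand in the registers `0` and `1`, the weight `w i` in
cell `i` of the real number array `0`, the value `v i e` in cell `i * m + e` of the real number
array `1`. Everything else is zero. -/
noncomputable def inputState {n m : ℕ} (w : Fin n → ℝ) (v : Fin n → Fin m → ℝ) : MemState where
  reg := fun r => if r = 0 then n else if r = 1 then m else 0
  rreg := fun _ => 0
  arr := fun _ _ => 0
  rarr := fun a j =>
    if a = 0 then (if h : j < n then w ⟨j, h⟩ else 0)
    else if a = 1 then
      (if h : j < n * m then
        v (finProdFinEquiv.symm ⟨j, h⟩).1 (finProdFinEquiv.symm ⟨j, h⟩).2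
      else 0)
    else 0

/-- The output: the agent who receives good `e` stands in cell `e` of the natural number
array `0`. -/
def OutputIs {n m : ℕ} (s : MemState) (X : Fin m → Fin n) : Prop :=
  ∀ e : Fin m, s.arr 0 (e : ℕ) = (X e : ℕ)

/-! Goods are assigned one at a time. The partial allocation always satisfies two conditions:
removing any one good from any bundle leaves weighted value at most the minimum weighted utility,
and the allocation maximizes a weighted sum of utilities.

Optimality. Give multiplier `hi` to the agents of a set `S` and `lo` to the others. The only
products of multiplier and value are `hi * hi`, `hi * lo` and `lo * lo`, and `Separated` ensures
that every assigned good lies with an agent for whom the product is maximal. By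
`isFPO_of_multipliers` a complete allocation of this kind is fPO.

One round. Let `l` be the poorest agent and `u` an unassigned good. Call an agent augmentable if she
values highly some good that nobody holds at high value, or one that is held at high value by an
agent already found augmentable. An induction along such chains shows that augmentable agents lie
outside `S` (`Augmenting.notMem`).

If `l` is augmentable, goods are passed along the chain: `l` gains `hi`, and each intermediate agent
loses one highly valued good and gets another. If the last good had an owner, that owner lies in
`S`, values both it and `u` at `lo`, and is compensated by `u`. The set `S` still works
(`Pending.next`, `Pending.finish`). Since `l` is outside `S`, all her goods are worth `hi` to her,
so removing any of them cancels the gain.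

If `l` is not augmentable, she gets `u` at value `lo`, and the complement of the augmentable set
becomes the new `S` (`Balanced.extend_small`). Removing any good takes away at least `lo`, so
fairness persists.

Utilities never decrease, and each round assigns one more good. There are thus `m` rounds. The
search makes at most `n + 1` passes over the table of values, so a round costs `O(n²m)` and the
total is `O(n²m²)`. This is stronger than the claimed bound, since `min (a / b) m ≥ 1` for `m ≥ 1`.
-/

/-! ### Total correctness with time bounds -/

/-- The program `P`, started in `s`, stops after at most `T` steps in a state satisfying `Q`. -/
def Runs (P : Prog) (s : MemState) (T : ℕ) (Q : MemState → Prop) : Prop :=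
  ∃ t s', Exec P s t s' ∧ t ≤ T ∧ Q s'

theorem Runs.mono {P : Prog} {s : MemState} {T T' : ℕ} {Q Q' : MemState → Prop}
    (h : Runs P s T Q) (hT : T ≤ T') (hQ : ∀ s', Q s' → Q' s') : Runs P s T' Q' := by
  obtain ⟨t, s', he, ht, hq⟩ := h
  exact ⟨t, s', he, ht.trans hT, hQ _ hq⟩

theorem Runs.seq {p q : Prog} {s : MemState} {T T' : ℕ} {R Q : MemState → Prop}
    (hp : Runs p s T R) (hq : ∀ s', R s' → Runs q s' T' Q) : Runs (.seq p q) s (T + T') Q := by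
  obtain ⟨t, s', he, ht, hr⟩ := hp
  obtain ⟨t', s'', he', ht', hq'⟩ := hq _ hr
  exact ⟨t + t', s'', .seq he he', by omega, hq'⟩

theorem Runs.cond {b : Test} {p q : Prog} {s : MemState} {T : ℕ} {Q : MemState → Prop}
    (hp : b.Holds s → Runs p s T Q) (hq : ¬ b.Holds s → Runs q s T Q) :
    Runs (.cond b p q) s (T + 1) Q := by
  by_cases h : b.Holds s
  · obtain ⟨t, s', he, ht, hr⟩ := hp h
    exact ⟨1 + t, s', .condTrue h he, by omega, hr⟩
  · obtain ⟨t, s', he, ht, hr⟩ := hq h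
    exact ⟨1 + t, s', .condFalse h he, by omega, hr⟩

theorem Runs.skip {s : MemState} {T : ℕ} {Q : MemState → Prop} (h : Q s) :
    Runs .skip s (T + 1) Q :=
  ⟨1, s, .skip s, by omega, h⟩

/-- A while loop with invariant `I`, whose body decreases the measure `μ`. -/
theorem Runs.loop {b : Test} {p : Prog} {T : ℕ} (I : MemState → Prop) (μ : MemState → ℕ)
    (hbody : ∀ s, I s → b.Holds s → Runs p s T (fun s' => I s' ∧ μ s' < μ s))
    {s : MemState} (hs : I s) :
    Runs (.loop b p) s ((T + 1) * μ s + 1) (fun s' => I s' ∧ ¬ b.Holds s') := by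
  induction hk : μ s using Nat.strong_induction_on generalizing s with
  | _ k ih =>
    by_cases h : b.Holds s
    · obtain ⟨t, s', he, ht, hI, hμ⟩ := hbody s hs h
      obtain ⟨t', s'', he', ht', hq⟩ := ih (μ s') (hk ▸ hμ) hI rfl
      refine ⟨1 + t + t', s'', .loopTrue h he he', ?_, hq⟩
      have : (T + 1) * (μ s' + 1) ≤ (T + 1) * k := Nat.mul_le_mul_left _ (by omega)
      rw [Nat.mul_add] at this
      omega
    · exact ⟨1, s, .loopFalse h, by omega, hs, h⟩

/-- Straight-line programs. -/
def block : List Instr → Prog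
  | [] => .skip
  | c :: l => .seq (.instr c) (block l)

theorem Runs.block {Q : MemState → Prop} : ∀ (l : List Instr) (s : MemState),
    Q (l.foldl (fun s c => c.run s) s) → Runs (block l) s (l.length + 1) Q
  | [], _, h => .skip h
  | c :: l, s, h => by
    have h1 : Runs (.instr c) s 1 (fun s' => s' = c.run s) := ⟨1, _, .instr c s, le_rfl, rfl⟩
    refine (h1.seq (T' := l.length + 1) (Q := Q) ?_).mono
      (by simp only [List.length_cons]; omega) (fun _ h => h)
    rintro _ rfl
    exact Runs.block l _ h

theorem Runs.block_seq {Q : MemState → Prop} {l : List Instr} {q : Prog} {s : MemState} {T : ℕ}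
    (h : Runs q (l.foldl (fun s c => c.run s) s) T Q) :
    Runs (.seq (_root_.block l) q) s (l.length + 1 + T) Q :=
  (Runs.block (Q := fun s' => s' = l.foldl (fun s c => c.run s) s) l s rfl).seq
    (fun _ h' => h' ▸ h)

section MemStateLemmas
variable (s : MemState) (d z a a' j r : ℕ) (x : ℝ)

@[simp] theorem MemState.setReg_reg : (s.setReg d z).reg r = if r = d then z else s.reg r := by
  simp [MemState.setReg, Function.update_apply]
@[simp] theorem MemState.setReg_rreg : (s.setReg d z).rreg = s.rreg := rfl
@[simp] theorem MemState.setReg_arr : (s.setReg d z).arr = s.arr := rfl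
@[simp] theorem MemState.setReg_rarr : (s.setReg d z).rarr = s.rarr := rfl
@[simp] theorem MemState.setRReg_rreg :
    (s.setRReg d x).rreg r = if r = d then x else s.rreg r := by
  simp [MemState.setRReg, Function.update_apply]
@[simp] theorem MemState.setRReg_reg : (s.setRReg d x).reg = s.reg := rfl
@[simp] theorem MemState.setRReg_arr : (s.setRReg d x).arr = s.arr := rfl
@[simp] theorem MemState.setRReg_rarr : (s.setRReg d x).rarr = s.rarr := rfl
@[simp] theorem MemState.setArr_arr : (s.setArr a j z).arr a' =
    if a' = a then Function.update (s.arr a) j z else s.arr a' := by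
  simp [MemState.setArr, Function.update_apply]
@[simp] theorem MemState.setArr_reg : (s.setArr a j z).reg = s.reg := rfl
@[simp] theorem MemState.setArr_rreg : (s.setArr a j z).rreg = s.rreg := rfl
@[simp] theorem MemState.setArr_rarr : (s.setArr a j z).rarr = s.rarr := rfl
@[simp] theorem MemState.setRArr_rarr : (s.setRArr a j x).rarr a' =
    if a' = a then Function.update (s.rarr a) j x else s.rarr a' := by
  simp [MemState.setRArr, Function.update_apply]
@[simp] theorem MemState.setRArr_reg : (s.setRArr a j x).reg = s.reg := rfl
@[simp] theorem MemState.setRArr_rreg : (s.setRArr a j x).rreg = s.rreg := rfl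
@[simp] theorem MemState.setRArr_arr : (s.setRArr a j x).arr = s.arr := rfl

end MemStateLemmas

/-! ### Bivalued instances and augmenting sequences -/

/-- A bivalued instance: `v (i * m + e)` is the value of good `e` for agent `i`. -/
structure Inst where
  /-- number of agents -/
  n : ℕ
  /-- number of goods -/
  m : ℕ
  /-- the large value -/
  hi : ℝ
  /-- the small value -/
  lo : ℝ
  /-- weights -/
  w : ℕ → ℝ
  /-- values -/
  v : ℕ → ℝ

namespace Inst

variable (D : Inst)

/-- The value of good `e` for agent `i`. -/
def val (i e : ℕ) : ℝ := D.v (i * D.m + e)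

/-- Only `lo ≤ hi` is demanded: the two values are found as the extremes of the table, and these
coincide when all entries are equal. -/
structure Valid : Prop where
  n_pos : 0 < D.n
  m_pos : 0 < D.m
  lo_pos : 0 < D.lo
  lo_le : D.lo ≤ D.hi
  w_pos : ∀ i < D.n, 0 < D.w i
  val_eq : ∀ i < D.n, ∀ e < D.m, D.val i e = D.hi ∨ D.val i e = D.lo

/-- The utility of agent `i` if good `e` belongs to agent `ow e`. -/
noncomputable def util (ow : ℕ → ℕ) (i : ℕ) : ℝ :=
  ∑ e ∈ Finset.range D.m, if ow e = i then D.val i e else 0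

/-- The number of unassigned goods; the owner of an unassigned good is `n`. -/
def free (ow : ℕ → ℕ) : ℕ := ((Finset.range D.m).filter (fun e => ow e = D.n)).card

/-- `h e` is the owner of `e` if the owner values `e` highly, and `n` otherwise. -/
structure Consistent (ow h : ℕ → ℕ) : Prop where
  owner_le : ∀ e < D.m, ow e ≤ D.n
  holder : ∀ e < D.m, (h e = D.n ∧ (ow e < D.n → D.val (ow e) e ≠ D.hi)) ∨
    (h e = ow e ∧ ow e < D.n ∧ D.val (ow e) e = D.hi)

/-- The set `S` of agents can be given larger multipliers than the other agents. -/
structure Separated (S : Set ℕ) (ow h : ℕ → ℕ) : Prop where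
  loose : ∀ e < D.m, h e = D.n → ∀ i ∈ S, D.val i e ≠ D.hi
  tight : ∀ e < D.m, h e < D.n → ∀ i ∈ S, D.val i e = D.hi → h e ∈ S
  small : ∀ e < D.m, h e = D.n → ow e < D.n → ow e ∈ S

/-- A partial allocation with utilities `V`, in which every bundle without one of its goods has
weighted value at most `M`. -/
structure Balanced (ow h : ℕ → ℕ) (V : ℕ → ℝ) (M : ℝ) : Prop where
  consistent : D.Consistent ow h
  separated : ∃ S, D.Separated S ow h
  util_eq : ∀ i < D.n, D.util ow i = V i
  bound : ∀ e < D.m, ow e < D.n → (V (ow e) - D.val (ow e) e) / D.w (ow e) ≤ M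

/-- A set of agents (those with `Z i = 1`) who can obtain a good of large value by a sequence of
exchanges; agent `i` starts with the good `nxt i`. -/
structure Augmenting (h Z nxt rk : ℕ → ℕ) : Prop where
  nxt_lt : ∀ i < D.n, Z i = 1 → nxt i < D.m
  nxt_val : ∀ i < D.n, Z i = 1 → D.val i (nxt i) = D.hi
  step : ∀ i < D.n, Z i = 1 → h (nxt i) = D.n ∨
    (h (nxt i) < D.n ∧ Z (h (nxt i)) = 1 ∧ rk (h (nxt i)) < rk i)

/-- The set given by `Z` cannot be enlarged. -/
def Closed (h Z : ℕ → ℕ) : Prop :=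
  ∀ i < D.n, Z i ≠ 1 → ∀ e < D.m, D.val i e = D.hi → h e ≠ D.n ∧ Z (h e) ≠ 1

/-- The situation while an augmenting sequence of exchanges is carried out: agent `c` still lacks a
good of large value. -/
structure Pending (S : Set ℕ) (Z nxt rk : ℕ → ℕ) (V : ℕ → ℝ) (M : ℝ) (u : ℕ)
    (ow₀ ow h : ℕ → ℕ) (c : ℕ) : Prop where
  consistent : D.Consistent ow h
  separated : D.Separated S ow h
  lt : c < D.n
  mem : Z c = 1
  step : ∀ z < D.n, Z z = 1 → rk z ≤ rk c → h (nxt z) = D.n ∨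
    (h (nxt z) < D.n ∧ Z (h (nxt z)) = 1 ∧ rk (h (nxt z)) < rk z)
  free_u : ow u = D.n
  util_eq : ∀ i < D.n, D.util ow i + (if i = c then D.hi else 0) = V i
  bound : ∀ e < D.m, ow e < D.n → (V (ow e) - D.val (ow e) e) / D.w (ow e) ≤ M
  bound_c : (V c - D.hi) / D.w c ≤ M
  free_eq : D.free ow = D.free ow₀
  keep : ∀ e, ow₀ e ≠ D.n → ow e ≠ D.n

variable {D}

/-! ### Moving a single good -/

theorem util_update {ow : ℕ → ℕ} {g c : ℕ} (hg : g < D.m) (i : ℕ) :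
    D.util (Function.update ow g c) i =
      D.util ow i + (if c = i then D.val i g else 0) - (if ow g = i then D.val i g else 0) := by
  unfold util
  have hg' : g ∈ Finset.range D.m := Finset.mem_range.2 hg
  rw [← Finset.add_sum_erase _ _ hg', ← Finset.add_sum_erase (Finset.range D.m)
    (fun e => if ow e = i then D.val i e else 0) hg']
  have : ∀ e ∈ (Finset.range D.m).erase g,
      (if Function.update ow g c e = i then D.val i e else 0) =
        if ow e = i then D.val i e else 0 := by
    intro e he
    rw [Function.update_of_ne (Finset.ne_of_mem_erase he)]
  rw [Finset.sum_congr rfl this]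
  simp only [Function.update_self]
  ring

theorem free_update {ow : ℕ → ℕ} {g c : ℕ} (hg : g < D.m) (hc : c ≠ D.n) :
    D.free (Function.update ow g c) + (if ow g = D.n then 1 else 0) = D.free ow := by
  unfold free
  have hg' : g ∈ Finset.range D.m := Finset.mem_range.2 hg
  simp only [Finset.card_filter]
  rw [← Finset.add_sum_erase _ _ hg', ← Finset.add_sum_erase (Finset.range D.m)
    (fun e => if ow e = D.n then 1 else 0) hg']
  have : ∀ e ∈ (Finset.range D.m).erase g,
      (if Function.update ow g c e = D.n then 1 else 0) = if ow e = D.n then 1 else 0 := by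
    intro e he
    rw [Function.update_of_ne (Finset.ne_of_mem_erase he)]
  rw [Finset.sum_congr rfl this]
  simp only [Function.update_self, if_neg hc]
  omega

theorem update_keep {ow : ℕ → ℕ} {g c : ℕ} (hc : c ≠ D.n) (e : ℕ) (he : ow e ≠ D.n) :
    Function.update ow g c e ≠ D.n := by
  rcases eq_or_ne e g with rfl | hne
  · simpa using hc
  · rwa [Function.update_of_ne hne]

theorem Consistent.holder_le {ow h : ℕ → ℕ} (hc : D.Consistent ow h) {e : ℕ} (he : e < D.m) :
    h e ≤ D.n := by
  rcases hc.holder e he with ⟨h1, _⟩ | ⟨h1, h2, _⟩ <;> omega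

theorem Consistent.of_free {ow h : ℕ → ℕ} (hc : D.Consistent ow h) {e : ℕ} (he : e < D.m)
    (h0 : ow e = D.n) : h e = D.n := by
  rcases hc.holder e he with ⟨h1, _⟩ | ⟨h1, h2, _⟩ <;> omega

/-- Assigning an unassigned good to an agent who does not value it highly. -/
theorem Consistent.assign_small {ow h : ℕ → ℕ} (hc : D.Consistent ow h) {u q : ℕ}
    (hu : u < D.m) (h0 : ow u = D.n) (hq : q < D.n) (hv : D.val q u ≠ D.hi) :
    D.Consistent (Function.update ow u q) h := by
  constructor
  · intro e he
    rcases eq_or_ne e u with rfl | hne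
    · simpa using hq.le
    · simpa [hne] using hc.owner_le e he
  · intro e he
    rcases eq_or_ne e u with rfl | hne
    · left
      simpa using ⟨hc.of_free he h0, fun _ => hv⟩
    · simpa [hne] using hc.holder e he

theorem Separated.assign_small {S : Set ℕ} {ow h : ℕ → ℕ} (hs : D.Separated S ow h) {u q : ℕ}
    (hq : q ∈ S) : D.Separated S (Function.update ow u q) h := by
  refine ⟨hs.loose, hs.tight, ?_⟩
  intro e he h1 h2
  rcases eq_or_ne e u with rfl | hne
  · simpa using hq
  · rw [Function.update_of_ne hne] at h2 ⊢
    exact hs.small e he h1 h2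

/-- Moving a good to an agent who values it highly. -/
theorem Consistent.assign_large {ow h : ℕ → ℕ} (hc : D.Consistent ow h) {g c : ℕ}
    (hcn : c < D.n) (hv : D.val c g = D.hi) :
    D.Consistent (Function.update ow g c) (Function.update h g c) := by
  constructor
  · intro e he
    rcases eq_or_ne e g with rfl | hne
    · simpa using hcn.le
    · simpa [hne] using hc.owner_le e he
  · intro e he
    rcases eq_or_ne e g with rfl | hne
    · right
      simpa using ⟨hcn, hv⟩
    · simpa [hne] using hc.holder e he

theorem Separated.assign_large {S : Set ℕ} {ow h : ℕ → ℕ} (hs : D.Separated S ow h) {g c : ℕ}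
    (hcn : c < D.n) (hv : ∀ i ∈ S, D.val i g ≠ D.hi) :
    D.Separated S (Function.update ow g c) (Function.update h g c) := by
  constructor
  · intro e he h1 i hi
    rcases eq_or_ne e g with rfl | hne
    · exact hv i hi
    · rw [Function.update_of_ne hne] at h1
      exact hs.loose e he h1 i hi
  · intro e he h1 i hi h2
    rcases eq_or_ne e g with rfl | hne
    · exact absurd h2 (hv i hi)
    · rw [Function.update_of_ne hne] at h1 ⊢
      exact hs.tight e he h1 i hi h2
  · intro e he h1 h2
    rcases eq_or_ne e g with rfl | hne
    · simp at h1; omega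
    · rw [Function.update_of_ne hne] at h1 h2 ⊢
      exact hs.small e he h1 h2

/-! ### Exchange sequences and the assignment of one more good -/

/-- Induction on the rank: if `i` were in `S`, her good `nxt i` could not be loose, so by `tight`
its holder, of smaller rank, would also be in `S`. -/
theorem Augmenting.notMem {S : Set ℕ} {ow h Z nxt rk : ℕ → ℕ} (ha : D.Augmenting h Z nxt rk)
    (hs : D.Separated S ow h) : ∀ i < D.n, Z i = 1 → i ∉ S := by
  intro i
  induction hk : rk i using Nat.strong_induction_on generalizing i with
  | _ k ih =>
    intro hi hz hiS
    have hg := ha.nxt_lt i hi hz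
    have hv := ha.nxt_val i hi hz
    rcases ha.step i hi hz with h1 | ⟨h1, h2, h3⟩
    · exact hs.loose _ hg h1 i hiS hv
    · exact ih _ (hk ▸ h3) _ rfl h1 h2 (hs.tight _ hg h1 i hiS hv)

/-- If the poorest agent `l` has no augmenting sequence, she gets an arbitrary unassigned good. -/
theorem Balanced.extend_small (hD : D.Valid) {ow h Z nxt rk : ℕ → ℕ} {V : ℕ → ℝ} {M : ℝ}
    (hb : D.Balanced ow h V M)
    (ha : D.Augmenting h Z nxt rk) (hcl : D.Closed h Z) {l u : ℕ} (hl : l < D.n)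
    (hlM : V l / D.w l ≤ M) (hz : Z l ≠ 1) (hu : u < D.m) (h0 : ow u = D.n) :
    D.Balanced (Function.update ow u l) h (Function.update V l (V l + D.lo)) M ∧
      D.free (Function.update ow u l) + 1 = D.free ow ∧
      ∀ e, ow e ≠ D.n → Function.update ow u l e ≠ D.n := by
  obtain ⟨S, hS⟩ := hb.separated
  have hhu := hb.consistent.of_free hu h0
  have hvu : D.val l u ≠ D.hi := fun hv => (hcl l hl hz u hu hv).1 hhu
  have hvu' : D.val l u = D.lo := (hD.val_eq l hl u hu).resolve_left hvu
  have hwl := hD.w_pos l hl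
  -- The new separating set is the complement of `Z`. Closedness gives `loose` and `tight`; owners
  -- of low-valued goods lie in the old `S`, which is disjoint from `Z`.
  refine ⟨⟨hb.consistent.assign_small hu h0 hl hvu, ⟨{i | i < D.n ∧ Z i ≠ 1}, ?_⟩, ?_, ?_⟩, ?_,
    fun e => update_keep hl.ne e⟩
  · refine Separated.assign_small ?_ ⟨hl, hz⟩
    constructor
    · rintro e he h1 i ⟨hi, hzi⟩ hv
      exact (hcl i hi hzi e he hv).1 h1
    · rintro e he h1 i ⟨hi, hzi⟩ hv
      exact ⟨h1, (hcl i hi hzi e he hv).2⟩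
    · intro e he h1 h2
      exact ⟨h2, fun hz' => ha.notMem hS _ h2 hz' (hS.small e he h1 h2)⟩
  · intro i hi
    rw [util_update hu, h0, if_neg (by omega : ¬ D.n = i), hb.util_eq i hi]
    rcases eq_or_ne l i with rfl | hne
    · simp [hvu']
    · simp [hne, hne.symm]
  · have key : ∀ e < D.m, ow e = l → (V l + D.lo - D.val l e) / D.w l ≤ M := by
      intro e he _
      refine le_trans ?_ hlM
      have : D.lo ≤ D.val l e := by
        rcases hD.val_eq l hl e he with h | h <;> rw [h]
        exact hD.lo_le
      gcongr
      linarith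
    intro e he h1
    rcases eq_or_ne e u with rfl | hne
    · simp only [Function.update_self, hvu']
      rwa [add_sub_cancel_right]
    · rw [Function.update_of_ne hne] at h1 ⊢
      rcases eq_or_ne (ow e) l with h2 | h2
      · rw [h2, Function.update_self]
        exact key e he h2
      · rw [Function.update_of_ne h2]
        exact hb.bound e he h1
  · have := free_update (ow := ow) hu hl.ne
    simpa [h0] using this

/-- The start of an augmenting sequence for the poorest agent `l`. -/
theorem Balanced.pending {ow h Z nxt rk : ℕ → ℕ} {V : ℕ → ℝ} {M : ℝ}
    (hb : D.Balanced ow h V M) (ha : D.Augmenting h Z nxt rk) {l u : ℕ} (hl : l < D.n)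
    (hlM : V l / D.w l ≤ M) (hz : Z l = 1) (h0 : ow u = D.n) :
    ∃ S, (∀ i < D.n, Z i = 1 → i ∉ S) ∧
      D.Pending S Z nxt rk (Function.update V l (V l + D.hi)) M u ow ow h l := by
  obtain ⟨S, hS⟩ := hb.separated
  refine ⟨S, ha.notMem hS, hb.consistent, hS, hl, hz, fun z hz hz' _ => ha.step z hz hz', h0,
    ?_, ?_, ?_, rfl, fun _ h => h⟩
  · intro i hi
    rw [hb.util_eq i hi]
    rcases eq_or_ne i l with rfl | hne
    · simp
    · simp [hne]
  · intro e he h1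
    rcases eq_or_ne (ow e) l with h2 | h2
    -- Being in `Z`, agent `l` is outside `S` and so owns no good at low value. Removing any of her
    -- goods cancels the added `hi`.
    · rcases hb.consistent.holder e he with ⟨h3, _⟩ | ⟨_, _, h4⟩
      · exact absurd (hS.small e he h3 h1) (ha.notMem hS _ h1 (h2 ▸ hz))
      · rw [h4, h2]
        simpa using hlM
    · rw [Function.update_of_ne h2]
      exact hb.bound e he h1
  · simpa using hlM

/-- Either the good is loose, or its holder is in `Z`, hence outside `S`; a member of `S` valuing it
highly would contradict `loose` or `tight`. This is why `S` survives the exchange. -/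
theorem Pending.loose_or {S : Set ℕ} {Z nxt rk : ℕ → ℕ} {V : ℕ → ℝ} {M : ℝ} {u : ℕ}
    {ow₀ ow h : ℕ → ℕ} {c : ℕ} (hp : D.Pending S Z nxt rk V M u ow₀ ow h c)
    (hS : ∀ i < D.n, Z i = 1 → i ∉ S) (hg : nxt c < D.m) :
    ∀ i ∈ S, D.val i (nxt c) ≠ D.hi := by
  intro i hi hv
  rcases hp.step c hp.lt hp.mem le_rfl with h1 | ⟨h1, h2, _⟩
  · exact hp.separated.loose _ hg h1 i hi hv
  · exact hS _ h1 h2 (hp.separated.tight _ hg h1 i hi hv)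

/-- `V` already records the final utilities, so only the moved good needs a new check, and for it
the claim is `bound_c`. -/
theorem Pending.bound_update {S : Set ℕ} {Z nxt rk : ℕ → ℕ} {V : ℕ → ℝ} {M : ℝ} {u : ℕ}
    {ow₀ ow h : ℕ → ℕ} {c g : ℕ} (hp : D.Pending S Z nxt rk V M u ow₀ ow h c)
    (hv : D.val c g = D.hi) :
    ∀ e < D.m, Function.update ow g c e < D.n →
      (V (Function.update ow g c e) - D.val (Function.update ow g c e) e) /
        D.w (Function.update ow g c e) ≤ M := by
  intro e he h1
  rcases eq_or_ne e g with rfl | hne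
  · simpa [hv] using hp.bound_c
  · rw [Function.update_of_ne hne] at h1 ⊢
    exact hp.bound e he h1

/-- An exchange that takes a good away from an agent who values it highly. -/
theorem Pending.next {S : Set ℕ} {Z nxt rk : ℕ → ℕ} {V : ℕ → ℝ} {M : ℝ} {u : ℕ}
    {ow₀ ow h : ℕ → ℕ} {c : ℕ} (hp : D.Pending S Z nxt rk V M u ow₀ ow h c)
    (hS : ∀ i < D.n, Z i = 1 → i ∉ S) (hu : u < D.m)
    (hg : nxt c < D.m) (hv : D.val c (nxt c) = D.hi) (ho : h (nxt c) < D.n) :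
    D.Pending S Z nxt rk V M u ow₀ (Function.update ow (nxt c) c) (Function.update h (nxt c) c)
      (h (nxt c)) ∧ rk (h (nxt c)) < rk c := by
  obtain ⟨hoz, hor⟩ : Z (h (nxt c)) = 1 ∧ rk (h (nxt c)) < rk c := by
    rcases hp.step c hp.lt hp.mem le_rfl with h1 | ⟨_, h2, h3⟩
    · omega
    · exact ⟨h2, h3⟩
  obtain ⟨how, hov⟩ : h (nxt c) = ow (nxt c) ∧ D.val (h (nxt c)) (nxt c) = D.hi := by
    rcases hp.consistent.holder _ hg with ⟨h1, _⟩ | ⟨h1, _, h3⟩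
    · omega
    · exact ⟨h1, h1 ▸ h3⟩
  have hoc : h (nxt c) ≠ c := fun h' => by rw [h'] at hor; exact lt_irrefl _ hor
  refine ⟨⟨hp.consistent.assign_large hp.lt hv,
    hp.separated.assign_large hp.lt (hp.loose_or hS hg), ho, hoz, ?_, ?_, ?_,
    hp.bound_update hv, ?_, ?_, fun e he => update_keep hp.lt.ne e (hp.keep e he)⟩, hor⟩
  · intro z hz hzz hzr
    have h1 := hp.step z hz hzz (hzr.trans hor.le)
    -- An agent of rank at most that of the next holder cannot start with the same good, as this
    -- holder would then have rank below her own. So the rest of the chain is untouched.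
    have hne : nxt z ≠ nxt c := by
      intro h2
      rw [h2] at h1
      rcases h1 with h1 | ⟨_, _, h1⟩ <;> omega
    rwa [Function.update_of_ne hne]
  · rw [Function.update_of_ne]
    · exact hp.free_u
    · rintro rfl
      have := hp.free_u
      omega
  · intro i hi
    rw [util_update hg, ← hp.util_eq i hi, ← how]
    rcases eq_or_ne c i with rfl | h1
    · simp [hoc, hoc.symm, hv]
    · rcases eq_or_ne (h (nxt c)) i with h2 | h2
      · subst h2
        simp [h1, hoc, hov]
      · simp [h1, h1.symm, h2, h2.symm]
  -- The old bound for the good just taken away is the required `bound_c` of the agent who lost it.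
  · have := hp.bound _ hg (how ▸ ho)
    rwa [← how, hov] at this
  · have := free_update (ow := ow) hg hp.lt.ne
    rw [if_neg (by omega)] at this
    have h2 := hp.free_eq
    omega

/-- The last exchange; the owner of the good, if there is one, is compensated by the good `u`. -/
theorem Pending.finish (hD : D.Valid) {S : Set ℕ} {Z nxt rk : ℕ → ℕ} {V : ℕ → ℝ} {M : ℝ} {u : ℕ}
    {ow₀ ow h : ℕ → ℕ} {c : ℕ} (hp : D.Pending S Z nxt rk V M u ow₀ ow h c)
    (hS : ∀ i < D.n, Z i = 1 → i ∉ S) (hu : u < D.m)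
    (hg : nxt c < D.m) (hv : D.val c (nxt c) = D.hi) (ho : h (nxt c) = D.n)
    {ow' : ℕ → ℕ} (how' : ow' = if ow (nxt c) < D.n
      then Function.update (Function.update ow (nxt c) c) u (ow (nxt c))
      else Function.update ow (nxt c) c) :
    D.Balanced ow' (Function.update h (nxt c) c) V M ∧ D.free ow' + 1 = D.free ow₀ ∧
      ∀ e, ow₀ e ≠ D.n → ow' e ≠ D.n := by
  have hcons := hp.consistent.assign_large hp.lt hv
  have hsep := hp.separated.assign_large hp.lt (hp.loose_or hS hg)
  have hf := free_update (ow := ow) hg hp.lt.ne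
  rw [hp.free_eq] at hf
  have hle := hp.consistent.owner_le _ hg
  by_cases hq : ow (nxt c) < D.n
  · rw [if_pos hq] at how'
    subst how'
    have hug : u ≠ nxt c := by
      rintro rfl
      have := hp.free_u
      omega
    -- The former owner lies in `S`, so both the lost good and `u` are worth `lo` to her: her
    -- utility and her bound do not change.
    have hqS := hp.separated.small _ hg ho hq
    have hvq : D.val (ow (nxt c)) (nxt c) = D.lo := by
      refine (hD.val_eq _ hq _ hg).resolve_left ?_
      rcases hp.consistent.holder _ hg with ⟨_, h1⟩ | ⟨h1, _⟩
      · exact h1 hq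
      · omega
    have hvu' : D.val (ow (nxt c)) u ≠ D.hi :=
      hp.separated.loose u hu (hp.consistent.of_free hu hp.free_u) _ hqS
    have hvu : D.val (ow (nxt c)) u = D.lo := (hD.val_eq _ hq u hu).resolve_left hvu'
    have hcq : c ≠ ow (nxt c) := fun h' => hS c hp.lt hp.mem (h' ▸ hqS)
    have hu1 : Function.update ow (nxt c) c u = D.n := by
      rw [Function.update_of_ne hug, hp.free_u]
    refine ⟨⟨hcons.assign_small hu hu1 hq hvu', ⟨S, hsep.assign_small hqS⟩, ?_, ?_⟩, ?_,
      fun e he => update_keep hq.ne e (update_keep hp.lt.ne e (hp.keep e he))⟩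
    · intro i hi
      rw [util_update hu, util_update hg, hu1, if_neg (by omega : ¬ D.n = i), ← hp.util_eq i hi]
      rcases eq_or_ne c i with rfl | h1
      · simp [hcq.symm, hv]
      · rcases eq_or_ne (ow (nxt c)) i with h2 | h2
        · subst h2
          simp [h1, h1.symm, hvq, hvu]
        · simp [h1, h1.symm, h2]
    · intro e he h1
      rcases eq_or_ne e u with rfl | hne
      · have := hp.bound _ hg hq
        simp only [Function.update_self, hvu]
        rwa [hvq] at this
      · rw [Function.update_of_ne hne] at h1 ⊢
        exact hp.bound_update hv e he h1
    · have h2 := free_update (ow := Function.update ow (nxt c) c) hu hq.ne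
      rw [if_pos hu1] at h2
      rw [if_neg (by omega)] at hf
      omega
  · rw [if_neg hq] at how'
    subst how'
    have hq' : ow (nxt c) = D.n := by omega
    refine ⟨⟨hcons, ⟨S, hsep⟩, ?_, hp.bound_update hv⟩, ?_,
      fun e he => update_keep hp.lt.ne e (hp.keep e he)⟩
    · intro i hi
      rw [util_update hg, hq', if_neg (by omega : ¬ D.n = i), ← hp.util_eq i hi]
      rcases eq_or_ne c i with rfl | h1
      · simp [hv]
      · simp [h1, h1.symm]
    · rwa [if_pos hq'] at hf

end Inst

/-! ### The program

Registers for natural numbers: `0`: number of agents, `1`: number of goods, `2`: one, `3`: zero,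
`6`: current good, `9`: poorest agent. Registers for real numbers: `0`: large value,
`1`: small value. Arrays of natural numbers: `0`: owners, `1`: owners who value the good highly,
`2`: agents who have an augmenting sequence, `3`: its first good. Arrays of real numbers:
`0`: weights, `1`: values, `2`: utilities. The remaining registers are used for loops and
intermediate results. -/

namespace Inst

variable {D : Inst}

/-- The memory state `s` represents the given data. -/
structure Mem (D : Inst) (ow h : ℕ → ℕ) (V : ℕ → ℝ) (u : ℕ) (s : MemState) : Prop where
  reg0 : s.reg 0 = D.n
  reg1 : s.reg 1 = D.m
  reg2 : s.reg 2 = 1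
  reg3 : s.reg 3 = 0
  reg6 : s.reg 6 = u
  rreg0 : s.rreg 0 = D.hi
  rreg1 : s.rreg 1 = D.lo
  rarr0 : s.rarr 0 = D.w
  rarr1 : s.rarr 1 = D.v
  arr0 : s.arr 0 = ow
  arr1 : s.arr 1 = h
  rarr2 : s.rarr 2 = V

/-! ### Selecting the poorest agent -/

/-- Find the poorest agent, and clear the set of agents who have an augmenting sequence. -/
def selectProg : Prog :=
  .seq (block [.const 8 0, .const 9 0])
    (.loop (.lt 8 0)
      (.seq (block [.store 2 8 3, .rload 2 2 8, .rload 3 0 8, .rdiv 2 2 3, .rload 3 2 9,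
          .rload 4 0 9, .rdiv 3 3 4])
        (.seq (.cond (.rlt 2 3) (block [.copy 9 8]) .skip) (block [.add 8 8 2]))))

structure SelectInv (D : Inst) (ow h : ℕ → ℕ) (V : ℕ → ℝ) (u i : ℕ) (s : MemState) : Prop where
  mem : D.Mem ow h V u s
  le : i ≤ D.n
  lt : s.reg 9 < D.n
  min : ∀ j < i, V (s.reg 9) / D.w (s.reg 9) ≤ V j / D.w j
  clear : ∀ j < i, s.arr 2 j = 0

theorem runs_select (hD : D.Valid) {ow h : ℕ → ℕ} {V : ℕ → ℝ} {u : ℕ} {s : MemState}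
    (hs : D.Mem ow h V u s) :
    Runs selectProg s (16 * D.n + 4) (fun s' => D.SelectInv ow h V u D.n s') := by
  have hn := hD.n_pos
  refine Runs.mono (Runs.block_seq (Runs.loop (T := 13)
    (fun s => D.SelectInv ow h V u (s.reg 8) s) (fun s => D.n - s.reg 8) ?_ ?_)) ?_ ?_
  · rintro s ⟨⟨h0, h1, h2, h3, h6, hr0, hr1, ha0, ha1, ho, hh, hV⟩, hle, hlt, hmin, hclear⟩ hb
    simp only [Test.Holds, h0] at hb
    refine Runs.block_seq (T := 5) (Runs.seq (T := 3) (T' := 2) (R := fun s' =>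
      D.Mem ow h V u s' ∧ s'.reg 8 = s.reg 8 ∧ s'.reg 9 < D.n ∧
      (∀ j < s.reg 8 + 1, V (s'.reg 9) / D.w (s'.reg 9) ≤ V j / D.w j) ∧
      ∀ j < s.reg 8 + 1, s'.arr 2 j = 0) (Runs.cond (fun hc => ?_) (fun hc => ?_)) ?_)
    · simp [Test.Holds, Instr.run, ha0, hV] at hc
      apply Runs.block
      refine ⟨?_, ?_, ?_, ?_, ?_⟩
      · constructor <;> simp [Instr.run, *]
      · simp [Instr.run]
      · simpa [Instr.run] using hb
      · intro j hj
        simp only [Instr.run, List.foldl]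
        simp
        rcases Nat.lt_succ_iff_lt_or_eq.1 hj with h | rfl
        · exact hc.le.trans (hmin j h)
        · exact le_rfl
      · intro j hj
        simp [Instr.run, Function.update_apply, h3]
        intro h
        exact hclear j (by omega)
    · simp [Test.Holds, Instr.run, ha0, hV] at hc
      apply Runs.skip
      refine ⟨?_, ?_, ?_, ?_, ?_⟩
      · constructor <;> simp [Instr.run, *]
      · simp [Instr.run]
      · simpa [Instr.run] using hlt
      · intro j hj
        simp only [Instr.run, List.foldl]
        simp
        rcases Nat.lt_succ_iff_lt_or_eq.1 hj with h | rfl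
        · exact hmin j h
        · exact hc
      · intro j hj
        simp [Instr.run, Function.update_apply, h3]
        intro h
        exact hclear j (by omega)
    · rintro s' ⟨⟨h0, h1, h2, h3, h6, hr0, hr1, ha0, ha1, ho, hh, hV⟩, h8, hlt', hmin', hclear'⟩
      apply Runs.block
      refine ⟨⟨?_, ?_, ?_, ?_, ?_⟩, ?_⟩
      · constructor <;> simp [Instr.run, *]
      · simp [Instr.run, h8, h2]; omega
      · simpa [Instr.run] using hlt'
      · simpa [Instr.run, h8, h2] using hmin'
      · simpa [Instr.run, h8, h2] using hclear'
      · simp [Instr.run, h8, h2]; omega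
  · obtain ⟨h0, h1, h2, h3, h6, hr0, hr1, ha0, ha1, ho, hh, hV⟩ := hs
    refine ⟨?_, ?_, ?_, ?_, ?_⟩
    · constructor <;> simp [Instr.run, *]
    all_goals simp [Instr.run, hn]
  · simp [Instr.run]; omega
  · rintro s' ⟨hI, hb⟩
    have : s'.reg 8 = D.n := by
      have := hI.le
      simp only [Test.Holds, hI.mem.reg0] at hb
      omega
    rwa [this] at hI

/-! ### Searching for augmenting sequences -/

/-- Test whether agent `reg 11` can be added by means of good `reg 13`. -/
def checkProg : Prog :=
  .seq (block [.load 14 2 11, .load 15 1 13, .load 15 2 15, .rload 2 1 12])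
    (.seq (.cond (.lt 14 15)
        (.cond (.rlt 2 0) .skip (block [.store 2 11 2, .store 3 11 13, .const 10 1])) .skip)
      (block [.add 12 12 2, .add 13 13 2]))

/-- Add agents to the set of agents who have an augmenting sequence as long as possible. -/
def searchProg : Prog :=
  .seq (block [.store 2 0 2, .const 10 1])
    (.loop (.lt 3 10)
      (.seq (block [.const 10 0, .const 11 0, .const 12 0])
        (.loop (.lt 11 0)
          (.seq (block [.const 13 0])
            (.seq (.loop (.lt 13 1) checkProg) (block [.add 11 11 2]))))))

/-- The number of agents in the set `Z`. -/
def size (D : Inst) (Z : ℕ → ℕ) : ℕ := ((Finset.range D.n).filter (fun i => Z i = 1)).card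

theorem size_le (Z : ℕ → ℕ) : D.size Z ≤ D.n :=
  (Finset.card_filter_le _ _).trans (Finset.card_range _).le

theorem size_update {Z : ℕ → ℕ} {i : ℕ} (hi : i < D.n) (hz : Z i ≠ 1) :
    D.size (Function.update Z i 1) = D.size Z + 1 := by
  unfold size
  rw [← Finset.card_insert_of_notMem (a := i) (s := (Finset.range D.n).filter (fun i => Z i = 1))
    (by simp [hz])]
  congr 1
  ext j
  rcases eq_or_ne j i with rfl | hne
  · simp [hi]
  · simp [hne]

/-- The invariant of the search. -/
structure SearchInv (D : Inst) (ow h : ℕ → ℕ) (V : ℕ → ℝ) (u l : ℕ) (s : MemState) : Prop where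
  mem : D.Mem ow h V u s
  reg9 : s.reg 9 = l
  bit : ∀ i ≤ D.n, s.arr 2 i = 0 ∨ s.arr 2 i = 1
  top : s.arr 2 D.n = 1
  aug : ∃ rk : ℕ → ℕ, D.Augmenting h (s.arr 2) (s.arr 3) rk ∧
    ∀ i < D.n, s.arr 2 i = 1 → rk i < D.size (s.arr 2)

/-- The pair of agent `i` and good `e` does not permit an extension of `Z`. -/
def Done (D : Inst) (h Z : ℕ → ℕ) (i e : ℕ) : Prop :=
  Z i ≠ 1 → D.val i e = D.hi → Z (h e) ≠ 1

/-- The invariant of one pass of the search, which started with `k` agents; the pairs satisfying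
`P` have been dealt with. -/
structure PassInv (D : Inst) (ow h : ℕ → ℕ) (V : ℕ → ℝ) (u l k : ℕ) (P : ℕ → ℕ → Prop)
    (s : MemState) : Prop where
  inv : D.SearchInv ow h V u l s
  progress : (s.reg 10 = 1 ∧ k < D.size (s.arr 2)) ∨
    (s.reg 10 = 0 ∧ k ≤ D.size (s.arr 2) ∧ ∀ i < D.n, ∀ e < D.m, P i e → D.Done h (s.arr 2) i e)

theorem SearchInv.of_eq {ow h : ℕ → ℕ} {V : ℕ → ℝ} {u l : ℕ} {s s' : MemState}
    (hs : D.SearchInv ow h V u l s) (hm : D.Mem ow h V u s') (h9 : s'.reg 9 = s.reg 9)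
    (h2 : s'.arr 2 = s.arr 2) (h3 : s'.arr 3 = s.arr 3) : D.SearchInv ow h V u l s' := by
  refine ⟨hm, h9.trans hs.reg9, ?_, ?_, ?_⟩
  · rw [h2]; exact hs.bit
  · rw [h2]; exact hs.top
  · rw [h2, h3]; exact hs.aug

theorem PassInv.of_eq {ow h : ℕ → ℕ} {V : ℕ → ℝ} {u l k : ℕ} {P P' : ℕ → ℕ → Prop}
    {s s' : MemState}
    (hs : D.PassInv ow h V u l k P s) (hP : ∀ i < D.n, ∀ e < D.m, P' i e → P i e)
    (hm : D.Mem ow h V u s') (h9 : s'.reg 9 = s.reg 9) (h10 : s'.reg 10 = s.reg 10)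
    (h2 : s'.arr 2 = s.arr 2) (h3 : s'.arr 3 = s.arr 3) : D.PassInv ow h V u l k P' s' := by
  refine ⟨hs.inv.of_eq hm h9 h2 h3, ?_⟩
  rw [h10, h2]
  rcases hs.progress with h' | ⟨h1, h2, h3⟩
  · exact .inl h'
  · exact .inr ⟨h1, h2, fun i hi e he hp => h3 i hi e he (hP i hi e he hp)⟩

theorem runs_check (hD : D.Valid) {ow h : ℕ → ℕ} (hc : D.Consistent ow h) {V : ℕ → ℝ}
    {u l k i e : ℕ} {P P' : ℕ → ℕ → Prop} {s : MemState} (hs : D.PassInv ow h V u l k P s)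
    (hi : i < D.n) (he : e < D.m)
    (hP : ∀ i' < D.n, ∀ e' < D.m, P' i' e' → P i' e' ∨ (i' = i ∧ e' = e))
    (h11 : s.reg 11 = i) (h12 : s.reg 12 = i * D.m + e) (h13 : s.reg 13 = e) :
    Runs checkProg s 14 (fun s' => D.PassInv ow h V u l k P' s' ∧ s'.reg 11 = i ∧
      s'.reg 12 = i * D.m + (e + 1) ∧ s'.reg 13 = e + 1) := by
  have hs' := hs
  obtain ⟨⟨⟨h0, h1, h2, h3, h6, hr0, hr1, ha0, ha1, ho, hh, hV⟩, h9, hbit, htop, rk, haug, hrk⟩,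
    hpr⟩ := hs
  have hev : s.rarr 1 (s.reg 12) = D.val i e := by rw [ha1, h12]; rfl
  refine Runs.block_seq (T := 9) (Runs.seq (T := 6) (T' := 3) (R := fun s' =>
      D.PassInv ow h V u l k P' s' ∧ s'.reg 11 = i ∧
      s'.reg 12 = i * D.m + e ∧ s'.reg 13 = e)
      (Runs.cond (fun hb => Runs.cond (fun hb' => ?_) (fun hb' => ?_)) (fun hb => ?_)) ?_)
  · simp [Test.Holds, Instr.run, hev, hr0] at hb'
    apply Runs.skip
    refine ⟨⟨hs'.inv.of_eq ?_ ?_ ?_ ?_, ?_⟩, ?_, ?_, ?_⟩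
    · constructor <;> simp [Instr.run, *]
    all_goals simp [Instr.run, *]
    refine hpr.imp id (fun hpr => ⟨hpr.1, hpr.2.1, fun i' hi' e' he' hp' => ?_⟩)
    rcases hP i' hi' e' he' hp' with h | ⟨rfl, rfl⟩
    · exact hpr.2.2 i' hi' e' he' h
    · intro _ hv
      exact absurd hv hb'.ne
  · simp [Test.Holds, Instr.run, hev, hr0] at hb'
    have hv : D.val i e = D.hi := by
      rcases hD.val_eq i hi e he with h | h
      · exact h
      · exact le_antisymm (h ▸ hD.lo_le) hb'
    simp [Test.Holds, Instr.run, h11, h13, hh] at hb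
    -- On bits, the test `Z i < Z (h e)` means `Z i = 0` and `Z (h e) = 1`. Cell `n` always contains
    -- `1`, so loose goods pass the same test.
    have hle := hc.holder_le he
    have hz1 : s.arr 2 (h e) = 1 := by
      rcases hbit _ hle with h | h
      · omega
      · exact h
    have hz0 : s.arr 2 i = 0 := by omega
    have hsz := size_update (D := D) (Z := s.arr 2) hi (by omega)
    have hne : h e ≠ i := fun h => by rw [h] at hz1; omega
    apply Runs.block
    -- The new agent gets the old size of `Z` as her rank, which exceeds all ranks given before.
    refine ⟨⟨⟨?_, ?_, ?_, ?_, Function.update rk i (D.size (s.arr 2)), ?_, ?_⟩, ?_⟩, ?_, ?_, ?_⟩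
    · constructor <;> simp [Instr.run, *]
    · simp [Instr.run, *]
    · intro j hj
      rcases eq_or_ne j i with rfl | hji
      · simp [Instr.run, h11, h2]
      · simpa [Instr.run, h11, h2, hji] using hbit j hj
    · simp [Instr.run, h11, h2, Function.update_apply, htop]
    · simp [Instr.run, h11, h2, h13]
      constructor
      · intro j hj hz
        rcases eq_or_ne j i with rfl | hji
        · simpa using he
        · rw [Function.update_of_ne hji] at hz ⊢
          exact haug.nxt_lt j hj hz
      · intro j hj hz
        rcases eq_or_ne j i with rfl | hji
        · simpa using hv
        · rw [Function.update_of_ne hji] at hz ⊢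
          exact haug.nxt_val j hj hz
      · intro j hj hz
        rcases eq_or_ne j i with rfl | hji
        · simp only [Function.update_self, Function.update_of_ne hne]
          rcases hle.lt_or_eq with h | h
          · exact .inr ⟨h, hz1, hrk _ h hz1⟩
          · exact .inl h
        · rw [Function.update_of_ne hji] at hz ⊢
          rcases haug.step j hj hz with h' | ⟨h1', h2', h3'⟩
          · exact .inl h'
          · have hne' : h (s.arr 3 j) ≠ i := fun h' => by rw [h'] at h2'; omega
            refine .inr ⟨h1', ?_, ?_⟩
            · rwa [Function.update_of_ne hne']
            · rwa [Function.update_of_ne hne', Function.update_of_ne hji]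
    · intro j hj
      simp [Instr.run, h11, h2]
      rw [hsz]
      intro hz
      rcases eq_or_ne j i with rfl | hji
      · simp
      · rw [Function.update_of_ne hji] at hz ⊢
        exact (hrk j hj hz).trans (Nat.lt_succ_self _)
    · left
      simp [Instr.run, h11, h2]
      rw [hsz]
      rcases hpr with h | h <;> omega
    all_goals simp [Instr.run, *]
  · simp [Test.Holds, Instr.run, h11, h13, hh] at hb
    apply Runs.skip
    refine ⟨⟨hs'.inv.of_eq ?_ ?_ ?_ ?_, ?_⟩, ?_, ?_, ?_⟩
    · constructor <;> simp [Instr.run, *]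
    all_goals simp [Instr.run, *]
    refine hpr.imp id (fun hpr => ⟨hpr.1, hpr.2.1, fun i' hi' e' he' hp' => ?_⟩)
    rcases hP i' hi' e' he' hp' with h | ⟨rfl, rfl⟩
    · exact hpr.2.2 i' hi' e' he' h
    · intro h1' _ h2'
      rcases hbit i' hi'.le with h' | h' <;> omega
  · rintro s' ⟨hp, h11', h12', h13'⟩
    have hm := hp.inv.mem
    apply Runs.block
    refine ⟨hp.of_eq (fun _ _ _ _ h => h) ?_ ?_ ?_ ?_ ?_, ?_, ?_, ?_⟩
    · obtain ⟨h0, h1, h2, h3, h6, hr0, hr1, ha0, ha1, ho, hh, hV⟩ := hm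
      constructor <;> simp [Instr.run, *]
    all_goals simp [Instr.run, hm.reg2, h11', h12', h13']
    omega

/-- Register `12` runs through the table without being reset between rows, as the machine cannot
multiply natural numbers. -/
theorem runs_row (hD : D.Valid) {ow h : ℕ → ℕ} (hc : D.Consistent ow h) {V : ℕ → ℝ}
    {u l k i : ℕ} {s : MemState} (hs : D.PassInv ow h V u l k (fun i' _ => i' < i) s)
    (hi : i < D.n) (h11 : s.reg 11 = i) (h12 : s.reg 12 = i * D.m) :
    Runs (.seq (block [.const 13 0])
      (.seq (.loop (.lt 13 1) checkProg) (block [.add 11 11 2]))) s (15 * D.m + 5)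
      (fun s' => D.PassInv ow h V u l k (fun i' _ => i' < i + 1) s' ∧ s'.reg 11 = i + 1 ∧
        s'.reg 12 = (i + 1) * D.m) := by
  refine Runs.mono (Runs.block_seq (Runs.seq (Runs.loop (T := 14)
    (fun s => D.PassInv ow h V u l k (fun i' e' => i' < i ∨ (i' = i ∧ e' < s.reg 13)) s ∧
      s.reg 13 ≤ D.m ∧ s.reg 11 = i ∧ s.reg 12 = i * D.m + s.reg 13)
    (fun s => D.m - s.reg 13) ?_ ?_) (T' := 2)
    (Q := fun s' => D.PassInv ow h V u l k (fun i' _ => i' < i + 1) s' ∧ s'.reg 11 = i + 1 ∧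
        s'.reg 12 = (i + 1) * D.m) ?_)) ?_ (fun _ h => h)
  · rintro s ⟨hp, hle, h11, h12⟩ hb
    simp only [Test.Holds, hp.inv.mem.reg1] at hb
    refine (runs_check hD hc (e := s.reg 13)
      (P' := fun i' e' => i' < i ∨ (i' = i ∧ e' < s.reg 13 + 1)) hp hi hb ?_ h11 h12 rfl).mono
      le_rfl ?_
    · intro i' _ e' _ h
      omega
    · rintro s' ⟨hp', h11', h12', h13'⟩
      rw [h13']
      exact ⟨⟨hp', hb, h11', h12'⟩, by omega⟩
  · refine ⟨hs.of_eq ?_ ?_ ?_ ?_ ?_ ?_, ?_, ?_, ?_⟩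
    · simp [Instr.run]
    · obtain ⟨h0, h1, h2, h3, h6, hr0, hr1, ha0, ha1, ho, hh, hV⟩ := hs.inv.mem
      constructor <;> simp [Instr.run, *]
    all_goals simp [Instr.run, h11, h12]
  · rintro s' ⟨⟨hp, hle, h11', h12'⟩, hb⟩
    simp only [Test.Holds, hp.inv.mem.reg1] at hb
    have hm : s'.reg 13 = D.m := by omega
    apply Runs.block
    refine ⟨hp.of_eq ?_ ?_ ?_ ?_ ?_ ?_, ?_, ?_⟩
    · intro i' _ e' he' h
      omega
    · obtain ⟨h0, h1, h2, h3, h6, hr0, hr1, ha0, ha1, ho, hh, hV⟩ := hp.inv.mem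
      constructor <;> simp [Instr.run, *]
    all_goals simp [Instr.run, h11', h12', hm, hp.inv.mem.reg2]
    ring
  · simp [Instr.run]; omega

theorem runs_pass (hD : D.Valid) {ow h : ℕ → ℕ} (hc : D.Consistent ow h) {V : ℕ → ℝ}
    {u l : ℕ} {s : MemState} (hs : D.SearchInv ow h V u l s) :
    Runs (.seq (block [.const 10 0, .const 11 0, .const 12 0])
        (.loop (.lt 11 0)
          (.seq (block [.const 13 0])
            (.seq (.loop (.lt 13 1) checkProg) (block [.add 11 11 2]))))) s
      ((15 * D.m + 6) * D.n + 5)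
      (fun s' => D.PassInv ow h V u l (D.size (s.arr 2)) (fun _ _ => True) s') := by
  refine Runs.mono (Runs.block_seq (Runs.loop (T := 15 * D.m + 5)
    (fun s' => D.PassInv ow h V u l (D.size (s.arr 2)) (fun i' _ => i' < s'.reg 11) s' ∧
      s'.reg 11 ≤ D.n ∧ s'.reg 12 = s'.reg 11 * D.m)
    (fun s => D.n - s.reg 11) ?_ ?_)) ?_ ?_
  · rintro s' ⟨hp, hle, h12⟩ hb
    simp only [Test.Holds, hp.inv.mem.reg0] at hb
    refine (runs_row hD hc hp hb rfl h12).mono le_rfl ?_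
    rintro s'' ⟨hp', h11', h12'⟩
    rw [h11']
    exact ⟨⟨hp', hb, h12'⟩, by omega⟩
  · refine ⟨⟨hs.of_eq ?_ ?_ ?_ ?_, .inr ?_⟩, ?_⟩
    · obtain ⟨h0, h1, h2, h3, h6, hr0, hr1, ha0, ha1, ho, hh, hV⟩ := hs.mem
      constructor <;> simp [Instr.run, *]
    all_goals simp [Instr.run]
  · simp [Instr.run]; linarith
  · rintro s' ⟨⟨hp, hle, h12⟩, hb⟩
    simp only [Test.Holds, hp.inv.mem.reg0] at hb
    exact hp.of_eq (fun i hi _ _ _ => by omega) hp.inv.mem rfl rfl rfl rfl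

/-- Every pass but the last enlarges `Z`. The measure adds the flag in register `10` to the number
of agents outside `Z`, to pay for the last pass. -/
theorem runs_search (hD : D.Valid) {ow h : ℕ → ℕ} (hc : D.Consistent ow h) {V : ℕ → ℝ}
    {u : ℕ} {s : MemState} (hs : D.SelectInv ow h V u D.n s) :
    Runs searchProg s (((15 * D.m + 6) * D.n + 6) * (D.n + 1) + 4)
      (fun s' => D.SearchInv ow h V u (s.reg 9) s' ∧ D.Closed h (s'.arr 2)) := by
  refine Runs.mono (Runs.block_seq (Runs.loop (T := (15 * D.m + 6) * D.n + 5)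
    (fun s' => D.SearchInv ow h V u (s.reg 9) s' ∧
      (s'.reg 10 = 1 ∨ (s'.reg 10 = 0 ∧ D.Closed h (s'.arr 2))))
    (fun s' => (D.n - D.size (s'.arr 2)) + s'.reg 10) ?_ ?_)) ?_ ?_
  · rintro s' ⟨hp, h10⟩ hb
    simp only [Test.Holds, hp.mem.reg3] at hb
    refine (runs_pass hD hc hp).mono le_rfl ?_
    intro s'' hp'
    have hsz := size_le (D := D) (s''.arr 2)
    rcases hp'.progress with ⟨h1, h2⟩ | ⟨h1, h2, h3⟩
    · exact ⟨⟨hp'.inv, .inl h1⟩, by omega⟩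
    · refine ⟨⟨hp'.inv, .inr ⟨h1, fun i hi hz e he hv => ?_⟩⟩, by omega⟩
      have := h3 i hi e he trivial hz hv
      -- A loose good has `h e = n`, and the sentinel `Z n = 1` would contradict `this`.
      refine ⟨fun h' => ?_, this⟩
      rw [h'] at this
      exact this hp'.inv.top
  · obtain ⟨⟨h0, h1, h2, h3, h6, hr0, hr1, ha0, ha1, ho, hh, hV⟩, -, h9, -, hcl⟩ := hs
    have hz : ∀ i < D.n, Function.update (s.arr 2) D.n 1 i ≠ 1 := by
      intro i hi
      rw [Function.update_of_ne hi.ne, hcl i hi]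
      omega
    refine ⟨⟨?_, ?_, ?_, ?_, fun _ => 0, ⟨?_, ?_, ?_⟩, ?_⟩, .inl ?_⟩
    · constructor <;> simp [Instr.run, *]
    · simp [Instr.run]
    · intro i hi
      rcases hi.lt_or_eq with hi | rfl
      · left
        simp [Instr.run, h0, hi.ne, hcl i hi]
      · right
        simp [Instr.run, h0, h2]
    · simp [Instr.run, h0, h2]
    · intro i hi hz'
      simp [Instr.run, h0, h2] at hz'
      exact absurd hz' (hz i hi)
    · intro i hi hz'
      simp [Instr.run, h0, h2] at hz'
      exact absurd hz' (hz i hi)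
    · intro i hi hz'
      simp [Instr.run, h0, h2] at hz'
      exact absurd hz' (hz i hi)
    · intro i hi hz'
      simp [Instr.run, h0, h2] at hz'
      exact absurd hz' (hz i hi)
    · simp [Instr.run]
  · have : ∀ A x y : ℕ, 2 + 1 + (A * (x - y + 1) + 1) ≤ A * (x + 1) + 4 := by
      intro A x y
      have : A * (x - y + 1) ≤ A * (x + 1) := Nat.mul_le_mul_left _ (by omega)
      omega
    simpa [Instr.run] using this _ _ _
  · rintro s' ⟨⟨hp, h10⟩, hb⟩
    simp only [Test.Holds, hp.mem.reg3] at hb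
    exact ⟨hp, (h10.resolve_left (by omega)).2⟩

/-! ### Performing the exchanges -/

/-- Carry out the sequence of exchanges starting with the poorest agent. -/
def walkProg : Prog :=
  .loop (.lt 16 0) (block [.load 17 3 16, .load 18 1 17, .load 19 0 17, .store 0 17 16,
    .store 1 17 16, .copy 16 18])

/-- Assign one more good. -/
def assignProg : Prog :=
  .seq (block [.load 14 2 9, .rload 2 2 9])
    (.cond (.lt 3 14)
      (.seq (block [.radd 2 2 0, .rstore 2 9 2, .copy 16 9])
        (.seq walkProg (.cond (.lt 19 0) (block [.store 0 6 19]) .skip)))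
      (block [.radd 2 2 1, .rstore 2 9 2, .store 0 6 9]))

/-- One more good has been assigned. -/
structure Extended (D : Inst) (M : ℝ) (ow₀ ow h : ℕ → ℕ) (V : ℕ → ℝ) : Prop where
  balanced : D.Balanced ow h V M
  free_eq : D.free ow + 1 = D.free ow₀
  keep : ∀ e, ow₀ e ≠ D.n → ow e ≠ D.n

/-- The rank of the agent in register `16` drops at each exchange. At the end register `19` contains
the former owner of the last good, and the good `u` is still to be handed to her if she exists. -/
theorem runs_walk (hD : D.Valid) {S : Set ℕ} {Z nxt rk : ℕ → ℕ} {V : ℕ → ℝ} {M : ℝ} {u : ℕ}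
    {ow h h' : ℕ → ℕ} {l : ℕ} (hp : D.Pending S Z nxt rk V M u ow ow h l)
    (hS : ∀ i < D.n, Z i = 1 → i ∉ S) (ha : D.Augmenting h' Z nxt rk) (hu : u < D.m)
    (hrk : rk l < D.n) {s : MemState} (hm : D.Mem ow h V u s) (h3 : s.arr 3 = nxt)
    (h16 : s.reg 16 = l) :
    Runs walkProg s (8 * D.n + 1) (fun s' => ∃ ow' h', D.Mem ow' h' V u s' ∧
      D.Extended M ow (if s'.reg 19 < D.n then Function.update ow' u (s'.reg 19) else ow') h' V) := by
  refine (Runs.loop (T := 7) (fun s' => ∃ ow' h', D.Mem ow' h' V u s' ∧ s'.arr 3 = nxt ∧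
      (D.Pending S Z nxt rk V M u ow ow' h' (s'.reg 16) ∨ (s'.reg 16 = D.n ∧
      D.Extended M ow
        (if s'.reg 19 < D.n then Function.update ow' u (s'.reg 19) else ow') h' V)))
      (fun s' => if s'.reg 16 < D.n then rk (s'.reg 16) + 1 else 0) ?_ ?_).mono ?_ ?_
  · rintro s ⟨ow', h', hm, h3, hp⟩ hb
    simp only [Test.Holds, hm.reg0] at hb
    replace hp := hp.resolve_right (by omega)
    have hg := ha.nxt_lt _ hp.lt hp.mem
    have hv := ha.nxt_val _ hp.lt hp.mem
    have hle := hp.consistent.holder_le hg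
    apply Runs.block
    have h16 : ∀ x, x = (List.foldl (fun s c => Instr.run c s) s
        [Instr.load 17 3 16, Instr.load 18 1 17, Instr.load 19 0 17, Instr.store 0 17 16,
          Instr.store 1 17 16, Instr.copy 16 18]) →
        x.reg 16 = h' (nxt (s.reg 16)) ∧ x.reg 19 = ow' (nxt (s.reg 16)) ∧
        x.arr 3 = nxt ∧ D.Mem (Function.update ow' (nxt (s.reg 16)) (s.reg 16))
          (Function.update h' (nxt (s.reg 16)) (s.reg 16)) V u x := by
      rintro x rfl
      obtain ⟨h0, h1, h2, h3', h6, hr0, hr1, ha0, ha1, ho, hh, hV⟩ := hm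
      refine ⟨by simp [Instr.run, *], by simp [Instr.run, *], by simp [Instr.run, *], ?_⟩
      constructor <;> simp [Instr.run, *]
    obtain ⟨e16, e19, e3, em⟩ := h16 _ rfl
    rw [e16, e19, e3, if_pos hb]
    by_cases ho : h' (nxt (s.reg 16)) < D.n
    · obtain ⟨hp', hlt⟩ := hp.next hS hu hg hv ho
      exact ⟨⟨_, _, em, rfl, .inl hp'⟩, by rw [if_pos ho]; omega⟩
    · obtain ⟨hb, hf, hk⟩ := hp.finish hD hS hu hg hv (by omega) rfl
      exact ⟨⟨_, _, em, rfl, .inr ⟨by omega, hb, hf, hk⟩⟩, by rw [if_neg ho]; omega⟩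
  · exact ⟨ow, h, hm, h3, .inl (h16 ▸ hp)⟩
  · simp only [h16, if_pos hp.lt]
    omega
  · rintro s' ⟨⟨ow', h', hm', -, hp'⟩, hb⟩
    simp only [Test.Holds, hm'.reg0] at hb
    rcases hp' with hp' | ⟨-, hp'⟩
    · exact absurd hp'.lt hb
    · exact ⟨ow', h', hm', hp'⟩

theorem runs_assign (hD : D.Valid) {ow h : ℕ → ℕ} {V : ℕ → ℝ} {u l : ℕ} {M : ℝ}
    (hbal : D.Balanced ow h V M) {s : MemState} (hs : D.SearchInv ow h V u l s)
    (hcl : D.Closed h (s.arr 2)) (hl : l < D.n) (hlM : V l / D.w l ≤ M) (hu : u < D.m)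
    (h0 : ow u = D.n) :
    Runs assignProg s (8 * D.n + 12) (fun s' => ∃ ow' h' x, 0 ≤ x ∧
      D.Mem ow' h' (Function.update V l (V l + x)) u s' ∧
      D.Extended M ow ow' h' (Function.update V l (V l + x))) := by
  obtain ⟨hm, h9, hbit, htop, rk, haug, hrk⟩ := hs
  obtain ⟨hr0, hr1, hr2, hr3, hr6, hrr0, hrr1, ha0, ha1, ho, hh, hV⟩ := hm
  refine (Runs.block_seq (T := 8 * D.n + 9) (Runs.cond (fun hb => ?_) (fun hb => ?_))).mono
    (by simp; omega) (fun _ h => h)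
  · simp [Test.Holds, Instr.run, hr3, h9] at hb
    have hz : s.arr 2 l = 1 := (hbit l hl.le).resolve_left (by omega)
    obtain ⟨S, hS, hp⟩ := hbal.pending haug hl hlM hz h0
    have hhi : 0 ≤ D.hi := hD.lo_pos.le.trans hD.lo_le
    refine Runs.mono (Runs.block_seq (Runs.seq (runs_walk hD hp hS haug hu
      ((hrk l hl hz).trans_le (size_le _)) ?_ ?_ ?_) (T' := 3) (Q := fun s' => ∃ ow' h' x, 0 ≤ x ∧
      D.Mem ow' h' (Function.update V l (V l + x)) u s' ∧
      D.Extended M ow ow' h' (Function.update V l (V l + x))) ?_)) ?_ (fun _ h => h)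
    · constructor <;> simp [Instr.run, *]
    · simp [Instr.run]
    · simp [Instr.run, h9]
    · rintro s' ⟨ow', h', ⟨hr0, hr1, hr2, hr3, hr6, hrr0, hrr1, ha0, ha1, ho, hh, hV⟩, he⟩
      refine Runs.cond (fun hb => ?_) (fun hb => ?_)
      · simp only [Test.Holds, hr0] at hb
        rw [if_pos hb] at he
        apply Runs.block
        refine ⟨_, h', D.hi, hhi, ?_, he⟩
        constructor <;> simp [Instr.run, *]
      · simp only [Test.Holds, hr0] at hb
        rw [if_neg hb] at he
        apply Runs.skip
        exact ⟨_, h', D.hi, hhi, ⟨hr0, hr1, hr2, hr3, hr6, hrr0, hrr1, ha0, ha1, ho, hh, hV⟩, he⟩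
    · simp; omega
  · simp [Test.Holds, Instr.run, hr3, h9] at hb
    obtain ⟨hb', hf, hk⟩ := hbal.extend_small hD haug hcl hl hlM (by omega) hu h0
    refine (Runs.block (Q := fun s' => ∃ ow' h' x, 0 ≤ x ∧
      D.Mem ow' h' (Function.update V l (V l + x)) u s' ∧
      D.Extended M ow ow' h' (Function.update V l (V l + x))) _ _ ?_).mono (by simp)
      (fun _ h => h)
    refine ⟨_, h, D.lo, hD.lo_pos.le, ?_, hb', hf, hk⟩
    constructor <;> simp [Instr.run, *]

end Inst

namespace Inst

variable {D : Inst}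

/-! ### The main loop -/

/-- Assign all goods. -/
def mainProg : Prog :=
  .loop (.lt 6 1) (.seq (block [.load 7 0 6])
    (.cond (.lt 7 0) (block [.add 6 6 2]) (.seq selectProg (.seq searchProg assignProg))))

/-- Every bundle without one of its goods has at most the weighted value of any other bundle. -/
def Fair (D : Inst) (ow h : ℕ → ℕ) (V : ℕ → ℝ) : Prop :=
  ∀ i < D.n, D.Balanced ow h V (V i / D.w i)

/-- The bound `M` is the weighted utility of the poorest agent before the round. As no utility
decreases, `M` is below every new weighted utility, which restores `Fair`. -/
theorem runs_iter (hD : D.Valid) {ow h : ℕ → ℕ} {V : ℕ → ℝ} {u : ℕ} {s : MemState}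
    (hs : D.Mem ow h V u s) (hf : D.Fair ow h V) (hu : u < D.m) (h0 : ow u = D.n) :
    Runs (.seq selectProg (.seq searchProg assignProg)) s
      (16 * D.n + 4 + (((15 * D.m + 6) * D.n + 6) * (D.n + 1) + 4 + (8 * D.n + 12)))
      (fun s' => ∃ ow' h' V', D.Mem ow' h' V' u s' ∧ D.Fair ow' h' V' ∧
        D.free ow' + 1 = D.free ow ∧ ∀ e, ow e ≠ D.n → ow' e ≠ D.n) := by
  refine (runs_select hD hs).seq ?_
  intro s1 h1
  refine (runs_search hD (hf _ h1.lt).consistent h1).seq ?_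
  rintro s2 ⟨h2, hcl⟩
  refine (runs_assign hD (hf _ h1.lt) h2 hcl h1.lt le_rfl hu h0).mono le_rfl ?_
  rintro s3 ⟨ow', h', x, hx, hm, hb, he, hk⟩
  refine ⟨ow', h', _, hm, fun i hi => ⟨hb.consistent, hb.separated, hb.util_eq,
    fun e he h => (hb.bound e he h).trans ((h1.min i hi).trans ?_)⟩, he, hk⟩
  have hw := hD.w_pos i hi
  rcases eq_or_ne i (s1.reg 9) with rfl | hne
  · simp only [Function.update_self]
    gcongr
    linarith
  · rw [Function.update_of_ne hne]

theorem iter_time {n m : ℕ} (hn : 0 < n) (hm : 0 < m) :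
    16 * n + 4 + (((15 * m + 6) * n + 6) * (n + 1) + 4 + (8 * n + 12)) ≤ 100 * (n * n * m) := by
  -- Expanded, the left side has coefficient sum 98, and each of its monomials is at most `n * n *
  -- m`.
  obtain ⟨n, rfl⟩ := Nat.exists_eq_add_of_le' hn
  obtain ⟨m, rfl⟩ := Nat.exists_eq_add_of_le' hm
  ring_nf
  nlinarith [Nat.zero_le (n * m), Nat.zero_le (n ^ 2 * m), Nat.zero_le (n ^ 2)]

/-- A round may assign a good other than the current one, so the pointer need not advance. The
measure therefore adds the number of unassigned goods to the distance of the pointer from `m`; it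
starts at no more than `2 * m`. -/
theorem runs_main (hD : D.Valid) {ow h : ℕ → ℕ} {V : ℕ → ℝ} {s : MemState}
    (hs : D.Mem ow h V 0 s) (hf : D.Fair ow h V) :
    Runs mainProg s (208 * (D.n * D.n * D.m * D.m) + 1)
      (fun s' => ∃ h' V', D.Fair (s'.arr 0) h' V' ∧ ∀ e < D.m, s'.arr 0 e < D.n) := by
  refine (Runs.loop (T := 100 * (D.n * D.n * D.m) + 3)
    (fun s => ∃ ow h V, D.Mem ow h V (s.reg 6) s ∧ D.Fair ow h V ∧ s.reg 6 ≤ D.m ∧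
      ∀ e < s.reg 6, ow e ≠ D.n) (fun s => (D.m - s.reg 6) + D.free (s.arr 0)) ?_ ?_).mono ?_ ?_
  · rintro s ⟨ow, h, V, hm, hf, hle, hown⟩ hb
    simp only [Test.Holds, hm.reg1] at hb
    have hm' := hm
    obtain ⟨h0, h1, h2, h3, h6, hr0, hr1, ha0, ha1, ho, hh, hV⟩ := hm
    refine Runs.block_seq (T := 100 * (D.n * D.n * D.m) + 1)
      (Runs.cond (fun hc => ?_) (fun hc => ?_)) |>.mono (by simp; omega) (fun _ h => h)
    · simp [Test.Holds, Instr.run, h0, ho] at hc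
      refine (Runs.block (Q := fun s' => (∃ ow h V, D.Mem ow h V (s'.reg 6) s' ∧ D.Fair ow h V ∧
        s'.reg 6 ≤ D.m ∧ ∀ e < s'.reg 6, ow e ≠ D.n) ∧
        (D.m - s'.reg 6) + D.free (s'.arr 0) < (D.m - s.reg 6) + D.free (s.arr 0)) _ _ ?_).mono
        ?_ (fun _ h => h)
      · refine ⟨⟨ow, h, V, ?_, hf, ?_, ?_⟩, ?_⟩
        · constructor <;> simp [Instr.run, *]
        · simp [Instr.run, h2]
          omega
        · intro e he
          simp [Instr.run, h2] at he
          rcases he.lt_or_eq with h | rfl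
          · exact hown e h
          · exact hc.ne
        · simp [Instr.run, h2]
          omega
      · have : 0 < D.n * D.n * D.m :=
          Nat.mul_pos (Nat.mul_pos hD.n_pos hD.n_pos) hD.m_pos
        simp
        omega
    · simp [Test.Holds, Instr.run, h0, ho] at hc
      refine Runs.mono (runs_iter hD (ow := ow) (h := h) (V := V) (u := s.reg 6) ?_ hf hb
        (le_antisymm ((hf 0 hD.n_pos).consistent.owner_le _ hb) hc))
        (iter_time hD.n_pos hD.m_pos) ?_
      · constructor <;> simp [Instr.run, *]
      · rintro s' ⟨ow', h', V', hm', hf', hfree, hk⟩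
        have e6 := hm'.reg6
        refine ⟨⟨ow', h', V', by rwa [e6], hf', by omega, ?_⟩, ?_⟩
        · intro e he
          rw [e6] at he
          exact hk e (hown e he)
        · rw [hm'.arr0, e6, ho]
          omega
  · exact ⟨ow, h, V, by rwa [hs.reg6], hf, by rw [hs.reg6]; omega, by rw [hs.reg6]; simp⟩
  · have h1 : D.free (s.arr 0) ≤ D.m :=
      (Finset.card_filter_le _ _).trans (Finset.card_range _).le
    have h2 : 0 < D.n * D.n * D.m :=
      Nat.mul_pos (Nat.mul_pos hD.n_pos hD.n_pos) hD.m_pos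
    have h3 := Nat.mul_le_mul (show 100 * (D.n * D.n * D.m) + 3 + 1 ≤ 104 * (D.n * D.n * D.m) by omega)
      (show D.m - s.reg 6 + D.free (s.arr 0) ≤ 2 * D.m by omega)
    have h4 : 104 * (D.n * D.n * D.m) * (2 * D.m) = 208 * (D.n * D.n * D.m * D.m) := by ring
    omega
  · rintro s' ⟨⟨ow', h', V', hm, hf', hle, hown⟩, hb⟩
    simp only [Test.Holds, hm.reg1] at hb
    refine ⟨h', V', hm.arr0 ▸ hf', fun e he => ?_⟩
    rw [hm.arr0]
    exact lt_of_le_of_ne ((hf' 0 hD.n_pos).consistent.owner_le e he) (hown e (by omega))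

/-! ### Initialization -/

/-- Mark all goods as unassigned, and find the largest and the smallest value. -/
def initProg : Prog :=
  .seq (block [.const 2 1, .rload 0 1 3, .rload 1 1 3])
    (.seq (.loop (.lt 4 1) (block [.store 0 4 0, .store 1 4 0, .add 5 5 0, .add 4 4 2]))
      (.loop (.lt 7 5) (.seq (block [.rload 2 1 7])
        (.seq (.cond (.rlt 0 2) (block [.rcopy 0 2]) .skip)
          (.seq (.cond (.rlt 2 1) (block [.rcopy 1 2]) .skip) (block [.add 7 7 2]))))))

/-- The instance with the extreme values found so far. -/
def current (n m : ℕ) (w v : ℕ → ℝ) (s : MemState) : Inst :=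
  ⟨n, m, s.rreg 0, s.rreg 1, w, v⟩

/-- The number of agents and goods, the weights, the values and the constants. -/
def Loaded (n m : ℕ) (w v : ℕ → ℝ) (s : MemState) : Prop :=
  (current n m w v s).Mem (s.arr 0) (s.arr 1) (fun _ => 0) 0 s

theorem Loaded.of_eq {n m : ℕ} {w v : ℕ → ℝ} {s s' : MemState} (hs : Loaded n m w v s)
    (h0 : s'.reg 0 = s.reg 0) (h1 : s'.reg 1 = s.reg 1) (h2 : s'.reg 2 = s.reg 2)
    (h3 : s'.reg 3 = s.reg 3) (h6 : s'.reg 6 = s.reg 6) (hr : s'.rarr = s.rarr) :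
    Loaded n m w v s' :=
  ⟨h0.trans hs.reg0, h1.trans hs.reg1, h2.trans hs.reg2, h3.trans hs.reg3, h6.trans hs.reg6,
    rfl, rfl, by rw [hr]; exact hs.rarr0, by rw [hr]; exact hs.rarr1, rfl, rfl,
    by rw [hr]; exact hs.rarr2⟩

/-- All goods are unassigned. -/
def Unassigned (n k : ℕ) (s : MemState) : Prop := ∀ e < k, s.arr 0 e = n ∧ s.arr 1 e = n

/-- Adding `n` once per good also produces the table length `m * n` in register `5`. -/
theorem runs_clear {n m : ℕ} {w v : ℕ → ℝ} {s : MemState} (hs : Loaded n m w v s)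
    (h4 : s.reg 4 = 0) (h5 : s.reg 5 = 0) :
    Runs (.loop (.lt 4 1) (block [.store 0 4 0, .store 1 4 0, .add 5 5 0, .add 4 4 2])) s
      (6 * m + 1) (fun s' => Loaded n m w v s' ∧ Unassigned n m s' ∧ s'.reg 5 = m * n ∧
        s'.reg 7 = s.reg 7 ∧ s'.rreg = s.rreg) := by
  refine (Runs.loop (T := 5) (fun s' => Loaded n m w v s' ∧ Unassigned n (s'.reg 4) s' ∧
    s'.reg 5 = s'.reg 4 * n ∧ s'.reg 7 = s.reg 7 ∧ s'.rreg = s.rreg ∧ s'.reg 4 ≤ m)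
    (fun s' => m - s'.reg 4) ?_ ?_).mono ?_ ?_
  · rintro s' ⟨hl, hu, h5, h7, hr, hle⟩ hb
    have h0 : s'.reg 0 = n := hl.reg0
    have h1 : s'.reg 1 = m := hl.reg1
    have h2 := hl.reg2
    simp only [Test.Holds, h1] at hb
    apply Runs.block
    refine ⟨⟨hl.of_eq ?_ ?_ ?_ ?_ ?_ ?_, ?_, ?_, ?_, ?_, ?_⟩, ?_⟩
    case refine_7 =>
      intro e he
      simp [Instr.run, h2] at he
      rcases he.lt_or_eq with h | rfl
      · simpa [Instr.run, h.ne] using hu e h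
      · simp [Instr.run, h0]
    case refine_8 => simp [Instr.run, h2, h5, h0]; ring
    all_goals simp [Instr.run, h2, h7, hr]
    all_goals omega
  · refine ⟨hs, ?_, ?_, rfl, rfl, ?_⟩ <;> simp [Unassigned, h4, h5]
  · simp [h4]
  · rintro s' ⟨⟨hl, hu, h5, h7, hr, hle⟩, hb⟩
    have h1 : s'.reg 1 = m := hl.reg1
    simp only [Test.Holds, h1] at hb
    have h4 : s'.reg 4 = m := by omega
    exact ⟨hl, h4 ▸ hu, h4 ▸ h5, h7, hr⟩

theorem runs_init {n m : ℕ} (hn : 0 < n) (hm : 0 < m) {w v : ℕ → ℝ} {a b : ℝ} (hb : 0 < b)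
    (hab : b < a) (hw : ∀ i < n, 0 < w i) (hv : ∀ q < n * m, v q = a ∨ v q = b) {s : MemState}
    (h0 : s.reg 0 = n) (h1 : s.reg 1 = m) (hreg : ∀ r, 2 ≤ r → s.reg r = 0)
    (hr0 : s.rarr 0 = w) (hr1 : s.rarr 1 = v) (hr2 : s.rarr 2 = fun _ => 0) :
    Runs initProg s (22 * (n * m) + 6) (fun s' => ∃ D : Inst, D.n = n ∧ D.m = m ∧ D.w = w ∧
      D.v = v ∧ D.Valid ∧ D.Mem (s'.arr 0) (s'.arr 1) (fun _ => 0) 0 s' ∧ Unassigned n m s') := by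
  have hpos : 0 < n * m := Nat.mul_pos hn hm
  refine Runs.mono (Runs.block_seq (Runs.seq (runs_clear (n := n) (m := m) (w := w) (v := v)
    ?_ ?_ ?_) (T' := 13 * (n * m) + 1) (Q := fun s' => ∃ D : Inst, D.n = n ∧ D.m = m ∧ D.w = w ∧
      D.v = v ∧ D.Valid ∧ D.Mem (s'.arr 0) (s'.arr 1) (fun _ => 0) 0 s' ∧ Unassigned n m s') ?_))
    ?_ (fun _ h => h)
  · have h3 := hreg 3 (by omega)
    have h6 := hreg 6 (by omega)
    constructor <;> simp [Instr.run, current, *]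
  · simp [Instr.run, hreg]
  · simp [Instr.run, hreg]
  · rintro s1 ⟨hl, hu, h5, h7, hrr⟩
    simp [Instr.run, hreg] at h7
    have e0 : s1.rreg 0 = v 0 := by simp [hrr, Instr.run, hr1, hreg]
    have e1 : s1.rreg 1 = v 0 := by simp [hrr, Instr.run, hr1, hreg]
    refine (Runs.loop (T := 12) (fun s' => Loaded n m w v s' ∧ Unassigned n m s' ∧
      s'.reg 5 = m * n ∧ s'.reg 7 ≤ n * m ∧ (s'.rreg 0 = a ∨ s'.rreg 0 = b) ∧
      (s'.rreg 1 = a ∨ s'.rreg 1 = b) ∧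
      ∀ q < s'.reg 7, s'.rreg 1 ≤ v q ∧ v q ≤ s'.rreg 0) (fun s' => n * m - s'.reg 7)
      ?_ ?_).mono ?_ ?_
    · rintro s ⟨hl, hu, h5, hle, hm0, hm1, hq⟩ hb
      simp only [Test.Holds, h5, mul_comm m n] at hb
      have hx : s.rarr 1 (s.reg 7) = v (s.reg 7) := by rw [hl.rarr1]; rfl
      have hvx := hv _ hb
      refine Runs.block_seq (T := 10) (Runs.seq (T := 3) (T' := 7) (R := fun s' =>
        s'.reg = s.reg ∧ s'.arr = s.arr ∧ s'.rarr = s.rarr ∧ s'.rreg 2 = v (s.reg 7) ∧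
        s'.rreg 1 = s.rreg 1 ∧ (s'.rreg 0 = a ∨ s'.rreg 0 = b) ∧ s.rreg 0 ≤ s'.rreg 0 ∧
        v (s.reg 7) ≤ s'.rreg 0) (Runs.cond (fun hc => ?_) (fun hc => ?_)) ?_)
      · simp [Test.Holds, Instr.run, hx] at hc
        apply Runs.block
        simp [Instr.run, hx, hvx, hc.le]
      · simp [Test.Holds, Instr.run, hx] at hc
        apply Runs.skip
        simp [Instr.run, hx, hc, hm0]
      rintro s' ⟨er, ea, err, e2, e1, e0, hle0, hle0'⟩
      refine Runs.seq (T := 3) (T' := 4) (R := fun s' =>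
        s'.reg = s.reg ∧ s'.arr = s.arr ∧ s'.rarr = s.rarr ∧
        (s'.rreg 0 = a ∨ s'.rreg 0 = b) ∧ s.rreg 0 ≤ s'.rreg 0 ∧ v (s.reg 7) ≤ s'.rreg 0 ∧
        (s'.rreg 1 = a ∨ s'.rreg 1 = b) ∧ s'.rreg 1 ≤ s.rreg 1 ∧ s'.rreg 1 ≤ v (s.reg 7))
        (Runs.cond (fun hc => ?_) (fun hc => ?_)) ?_
      · simp [Test.Holds, e2, e1] at hc
        apply Runs.block
        simp [Instr.run, *, hc.le]
      · simp [Test.Holds, e2, e1] at hc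
        apply Runs.skip
        simp [*]
      rintro s'' ⟨er, ea, err, e0, hle0, hle0', e1, hle1, hle1'⟩
      refine (Runs.block (Q := fun s' => (Loaded n m w v s' ∧ Unassigned n m s' ∧
        s'.reg 5 = m * n ∧ s'.reg 7 ≤ n * m ∧ (s'.rreg 0 = a ∨ s'.rreg 0 = b) ∧
        (s'.rreg 1 = a ∨ s'.rreg 1 = b) ∧
        ∀ q < s'.reg 7, s'.rreg 1 ≤ v q ∧ v q ≤ s'.rreg 0) ∧ n * m - s'.reg 7 < n * m - s.reg 7)
        _ _ ?_).mono (by simp) (fun _ h => h)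
      have h2 := hl.reg2
      refine ⟨⟨hl.of_eq ?_ ?_ ?_ ?_ ?_ ?_, ?_, ?_, ?_, ?_, ?_, ?_⟩, ?_⟩
      case refine_7 => simpa [Unassigned, Instr.run, ea] using hu
      case refine_12 =>
        intro q hq'
        simp [Instr.run, er, h2] at hq' ⊢
        rcases hq'.lt_or_eq with h | rfl
        · exact ⟨hle1.trans (hq q h).1, (hq q h).2.trans hle0⟩
        · exact ⟨hle1', hle0'⟩
      all_goals simp [Instr.run, er, h2, h5, err, e0, e1]
      all_goals omega
    · refine ⟨hl, hu, h5, by omega, by rw [e0]; exact hv 0 hpos, by rw [e1]; exact hv 0 hpos, ?_⟩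
      intro q hq
      omega
    · simp [h7]
    · rintro s2 ⟨⟨hl, hu, h5, hle, hm0, hm1, hq⟩, hb'⟩
      simp only [Test.Holds, h5, mul_comm m n] at hb'
      have h7 : s2.reg 7 = n * m := by omega
      rw [h7] at hq
      refine ⟨current n m w v s2, rfl, rfl, rfl, rfl, ⟨hn, hm, ?_, ?_, hw, ?_⟩, hl, hu⟩
      · change 0 < s2.rreg 1
        rcases hm1 with h | h <;> rw [h] <;> linarith
      · exact (hq 0 hpos).1.trans (hq 0 hpos).2
      · intro i hi e he
        have hlt : i * m + e < n * m := by
          have : (i + 1) * m ≤ n * m := Nat.mul_le_mul_right _ hi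
          rw [Nat.add_mul, one_mul] at this
          change e < m at he
          omega
        obtain ⟨h1, h2⟩ := hq _ hlt
        change v (i * m + e) = s2.rreg 0 ∨ v (i * m + e) = s2.rreg 1
        -- The extremes found are themselves `a` or `b`, so an entry squeezed between them equals
        -- one of them.
        rcases hv _ hlt with h | h <;> rw [h] at h1 h2 ⊢ <;> rcases hm0 with h' | h' <;>
          rcases hm1 with h'' | h'' <;> rw [h'] at h2 ⊢ <;> rw [h''] at h1 ⊢ <;> simp <;> linarith
  · have : m ≤ n * m := Nat.le_mul_of_pos_left _ hn
    simp
    omega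

theorem fair_unassigned {ow h : ℕ → ℕ} (hu : ∀ e < D.m, ow e = D.n ∧ h e = D.n) :
    D.Fair ow h (fun _ => 0) := by
  intro i _
  refine ⟨⟨fun e he => (hu e he).1.le, fun e he => .inl ⟨(hu e he).2, fun h' => ?_⟩⟩,
    ⟨∅, ⟨?_, ?_, ?_⟩⟩, ?_, ?_⟩
  · exact absurd (hu e he).1 h'.ne
  · simp
  · simp
  · intro e he _ h'
    exact absurd (hu e he).1 h'.ne
  · intro i hi
    refine Finset.sum_eq_zero fun e he => if_neg ?_
    have := (hu e (Finset.mem_range.1 he)).1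
    omega
  · intro e he h'
    exact absurd (hu e he).1 h'.ne

end Inst

/-! ### The resulting allocation -/

/-- An allocation that maximizes a positively weighted sum of utilities is fractionally Pareto
optimal. -/
theorem isFPO_of_multipliers {n m : ℕ} {v : Fin n → Fin m → ℝ} {X : Fin m → Fin n}
    (l : Fin n → ℝ) (hl : ∀ i, 0 < l i) (h : ∀ e i, l i * v i e ≤ l (X e) * v (X e) e) :
    IsFPO v X := by
  rintro ⟨y, ⟨hy0, hy1⟩, hle, j, hlt⟩
  have h1 : ∑ i, l i * bundleValue v i (bundle X i) < ∑ i, l i * fracValue v y i :=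
    Finset.sum_lt_sum (fun i _ => mul_le_mul_of_nonneg_left (hle i) (hl i).le)
      ⟨j, Finset.mem_univ _, mul_lt_mul_of_pos_left hlt (hl j)⟩
  have h2 : ∑ i, l i * bundleValue v i (bundle X i) = ∑ e, l (X e) * v (X e) e := by
    simp only [bundleValue, bundle, Finset.sum_filter, Finset.mul_sum]
    rw [Finset.sum_comm]
    refine Finset.sum_congr rfl fun e _ => ?_
    simp
  have h3 : ∑ i, l i * fracValue v y i ≤ ∑ e, l (X e) * v (X e) e := by
    simp only [fracValue, Finset.mul_sum]
    rw [Finset.sum_comm]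
    refine Finset.sum_le_sum fun e _ => ?_
    calc ∑ i, l i * (y i e * v i e) ≤ ∑ i, y i e * (l (X e) * v (X e) e) := by
          refine Finset.sum_le_sum fun i _ => ?_
          rw [mul_left_comm]
          exact mul_le_mul_of_nonneg_left (h e i) (hy0 i e)
      _ = l (X e) * v (X e) e := by rw [← Finset.sum_mul, hy1, one_mul]
  linarith

theorem Inst.Fair.isWEQX_isFPO {D : Inst} (hD : D.Valid) {ow h : ℕ → ℕ} {V : ℕ → ℝ}
    (hf : D.Fair ow h V) {v : Fin D.n → Fin D.m → ℝ} (hv : ∀ (i : Fin D.n) (e : Fin D.m), D.val i e = v i e)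
    {X : Fin D.m → Fin D.n} (hX : ∀ e : Fin D.m, ow e = X e) :
    IsWEQX (fun i => D.w i) v X ∧ IsFPO v X := by
  have hval : ∀ i : Fin D.n, bundleValue v i (bundle X i) = V i := by
    intro i
    rw [← (hf i i.2).util_eq i i.2, Inst.util, Finset.sum_range, bundleValue, bundle,
      Finset.sum_filter]
    refine Finset.sum_congr rfl fun e _ => ?_
    simp [hX, hv, Fin.ext_iff]
  constructor
  · intro i j e he
    have hej : X e = j := by simpa [bundle] using he
    have h1 : bundleValue v j (bundle X j \ {e}) = V j - D.val j e := by
      rw [← hval j, hv, bundleValue, bundleValue, Finset.sdiff_singleton_eq_erase,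
        ← Finset.add_sum_erase _ _ he]
      ring
    have := (hf i i.2).bound e e.2 (by rw [hX]; exact (X e).2)
    rw [hX, hej] at this
    rwa [h1, hval]
  · obtain ⟨S, hS⟩ := (hf 0 hD.n_pos).separated
    have hc := (hf 0 hD.n_pos).consistent
    have hhi : 0 < D.hi := hD.lo_pos.trans_le hD.lo_le
    have hlo := hD.lo_pos
    classical
    -- A good held at low value has owner in `S` and product `hi * lo`, which only a member of `S`
    -- valuing it at `hi` could beat; `loose` excludes this. A good held highly outside `S` has
    -- product `lo * hi`, and `tight` excludes the same rival.
    refine isFPO_of_multipliers (fun i => if (i : ℕ) ∈ S then D.hi else D.lo) ?_ ?_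
    · intro i
      split_ifs
      exacts [hhi, hlo]
    · intro e i
      rw [← hv, ← hv]
      have hle := hD.lo_le
      have hi := hD.val_eq i i.2 e e.2
      have hmul : D.lo * D.hi ≤ D.hi * D.hi := by gcongr
      have hmul' : D.lo * D.lo ≤ D.hi * D.lo := by gcongr
      have hmul2 : D.lo * D.lo ≤ D.lo * D.hi := by gcongr
      have hcm := mul_comm D.lo D.hi
      have hXe := hX e
      rcases hc.holder e e.2 with ⟨h1, h2⟩ | ⟨h1, h2, h3⟩
      · have hS' := hS.small e e.2 h1 (by rw [hXe]; exact (X e).2)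
        have h4 := (hD.val_eq _ (X e).2 e e.2).resolve_left
          (hXe ▸ h2 (by rw [hXe]; exact (X e).2))
        rw [hXe] at hS'
        simp only [if_pos hS', h4]
        split_ifs with his
        · rw [hi.resolve_left (hS.loose e e.2 h1 i his)]
        · rcases hi with h | h <;> rw [h] <;> linarith
      · rw [hXe] at h1 h2 h3
        rw [h3]
        by_cases hXS : (X e : ℕ) ∈ S
        · simp only [if_pos hXS]
          split_ifs <;> rcases hi with h | h <;> rw [h] <;> linarith
        · simp only [if_neg hXS]
          split_ifs with his
          · have : D.val i e ≠ D.hi := fun h' =>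
              hXS (h1 ▸ hS.tight e e.2 (by rw [h1]; exact h2) i his h')
            rw [hi.resolve_left this]
            linarith
          · rcases hi with h | h
            · rw [h]
            · rw [h]; linarith

/-! ### The complete program and its running time -/

theorem theorem3 :
    ∃ (P : Prog) (C : ℕ), ∀ (n m : ℕ) (w : Fin n → ℝ) (v : Fin n → Fin m → ℝ) (a b : ℝ),
      1 ≤ n → (∀ i, 0 < w i) → 0 < b → b < a → (∀ i e, v i e = a ∨ v i e = b) →
      ∃ (t : ℕ) (s : MemState) (X : Fin m → Fin n),
        Exec P (inputState w v) t s ∧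
        (t : ℝ) ≤ C * (min (a / b) (m : ℝ) * (n : ℝ) ^ 2 * (m : ℝ) ^ 2 + 1) ∧
        OutputIs s X ∧ IsWEQX w v X ∧ IsFPO v X := by
  refine ⟨.cond (.lt 3 1) (.seq Inst.initProg Inst.mainProg) .skip, 240, ?_⟩
  intro n m w v a b hn hw hb hab hv
  rcases Nat.eq_zero_or_pos m with rfl | hm
  -- Without goods the program stops after two steps, which the summand `1` in the bound pays for.
  · refine ⟨1 + 1, _, Fin.elim0, .condFalse ?_ (.skip _), by norm_num, fun e => e.elim0,
      fun _ _ e => e.elim0, ?_⟩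
    · simp [Test.Holds, inputState]
    · rintro ⟨y, -, -, j, hj⟩
      simp [bundleValue, fracValue, bundle] at hj
  set w' := (inputState w v).rarr 0 with hw'
  set v' := (inputState w v).rarr 1 with hv'
  have hwi : ∀ i : Fin n, w' i = w i := fun i => by simp [w', inputState]
  have hvj : ∀ j (hj : j < n * m), v' j =
      v (finProdFinEquiv.symm ⟨j, hj⟩).1 (finProdFinEquiv.symm ⟨j, hj⟩).2 := fun j hj => by
    simp [v', inputState, hj]
  have hvi : ∀ (i : Fin n) (e : Fin m), v' (i * m + e) = v i e := by
    intro i e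
    have h1 : (i * m + e : ℕ) = (finProdFinEquiv (i, e) : Fin (n * m)) := by
      simp [finProdFinEquiv, mul_comm, add_comm]
    rw [h1, hvj _ (Fin.is_lt _)]
    simp only [Fin.eta, Equiv.symm_apply_apply]
  have hrun : Runs (.cond (.lt 3 1) (.seq Inst.initProg Inst.mainProg) .skip) (inputState w v)
      (240 * (n * n * m * m)) (fun s => ∃ X : Fin m → Fin n,
        OutputIs s X ∧ IsWEQX w v X ∧ IsFPO v X) := by
    have hpos : 0 < n * m := Nat.mul_pos hn hm
    have hle : n * m ≤ n * n * m * m := by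
      calc n * m = n * m * 1 := (mul_one _).symm
        _ ≤ n * m * (n * m) := Nat.mul_le_mul_left _ hpos
        _ = n * n * m * m := by ring
    refine Runs.mono (Runs.cond (T := 22 * (n * m) + 6 + (208 * (n * n * m * m) + 1))
      (fun _ => ?_) (fun h => ?_)) (by omega) (fun _ h => h)
    · refine (Inst.runs_init hn hm hb hab (w := w') (v := v') ?_ ?_ ?_ ?_ ?_ rfl rfl ?_).seq ?_
      · intro i hi
        rw [hwi ⟨i, hi⟩]
        exact hw _
      · intro q hq
        rw [hvj q hq]
        exact hv _ _
      · simp [inputState]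
      · simp [inputState]
      · intro r hr
        simp only [inputState]
        rw [if_neg (by omega), if_neg (by omega)]
      · simp [inputState]
      rintro s ⟨D, rfl, rfl, hDw, hDv, hD, hM, hu⟩
      refine (Inst.runs_main hD hM (Inst.fair_unassigned hu)).mono le_rfl ?_
      rintro s' ⟨h', V', hf, hown⟩
      refine ⟨fun e => ⟨s'.arr 0 e, hown e e.2⟩, fun e => rfl, ?_⟩
      have := hf.isWEQX_isFPO hD (v := v) (X := fun e => ⟨s'.arr 0 e, hown e e.2⟩)
        (fun i e => by rw [Inst.val, hDv]; exact hvi i e) (fun e => rfl)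
      simpa only [hDw, hwi] using this
    · simp [Test.Holds, inputState] at h
      omega
  obtain ⟨t, s, he, ht, X, hX⟩ := hrun
  refine ⟨t, s, X, he, ?_, hX⟩
  -- The factor `min (a / b) m` is at least `1`, so the bound of order `n²m²` suffices.
  have hmin : 1 ≤ min (a / b) (m : ℝ) :=
    le_min ((one_le_div hb).2 hab.le) (by exact_mod_cast hm)
  have h1 : (t : ℝ) ≤ 240 * ((n : ℝ) ^ 2 * (m : ℝ) ^ 2) := by
    calc (t : ℝ) ≤ ((240 * (n * n * m * m) : ℕ) : ℝ) := by exact_mod_cast ht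
      _ = _ := by push_cast; ring
  have h2 : (n : ℝ) ^ 2 * (m : ℝ) ^ 2 ≤ min (a / b) (m : ℝ) * (n : ℝ) ^ 2 * (m : ℝ) ^ 2 := by
    rw [mul_assoc]
    exact le_mul_of_one_le_left (by positivity) hmin
  push_cast
  linarith
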